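/- Let $\mathcal Y$ be a complex Hilbert space and let $M$ be a (possibly unbounded) positive selfadjoint operator in $\mathcal Y$. For a bounded accretive operator $C$ on $\mathcal Y$ consider in the Hilbert space $\mathcal Y\oplus\mathcal Y$ the operator $$\mathcal A^+_C=\begin{pmatrix}-C&-M^{1/2}\\ M^{1/2}&0\end{pmatrix},\qquad \mathcal D(\mathcal A^+_C)=\mathcal D(M^{1/2})\oplus\mathcal D(M^{1/2}).$$ Let $\mathcal X_C=\mathcal N(\mathcal A^+_C)^\perp$ be the orthogonal complement of its null-space, and let $\mathcal A_C$ be the inverse of the part of $\mathcal A^+_C$ in $\mathcal X_C$, i.e. $\mathcal A_Cx=y$ if and only if $x,y\in\mathcal X_C$, $y\in\mathcal D(\mathcal A^+_C)$ and $\mathcal A^+_Cy=x$. The system $M\ddot y+C\dot y+y=0$ is called exponentially stable if the operator $\mathcal A_C$ generates a strongly continuous semigroup $(e^{\mathcal A_Ct})_{t\ge 0}$ on $\mathcal X_C$ such that $\|e^{\mathcal A_Ct}\|\le c\,e^{-\beta t}$ for all $t\ge 0$, for some constants $c,\beta>0$. Let $C^{(1)}$ and $D$ be bounded symmetric operators on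 $\mathcal Y$ such that, in the sense of quadratic forms, $$0\le C^{(1)}\le D\le\alpha C^{(1)}$$ for some real $\alpha$. Then the system $M\ddot y+C^{(1)}\dot y+y=0$ is exponentially stable if and only if the system $M\ddot y+D\dot y+y=0$ is exponentially stable. In particular, if $C\ge 0$ is a bounded symmetric operator and the system $M\ddot y+C\dot y+y=0$ is exponentially stable, then so is $M\ddot y+\alpha C\dot y+y=0$ for every $\alpha>0$. -/

import Mathlib

open Filter Topology
open scoped InnerProductSpace

noncomputable section

namespace DampedSystem

/-! ### Strongly continuous semigroups -/

section Semigroup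

variable {X : Type*} [NormedAddCommGroup X] [NormedSpace ℂ X]

/-- `T` is a strongly continuous semigroup of bounded operators on `X`
(only the values `T t` with `0 ≤ t` matter). -/
structure IsC0Semigroup (T : ℝ → X →L[ℂ] X) : Prop where
  map_zero : T 0 = ContinuousLinearMap.id ℂ X
  map_add : ∀ s t : ℝ, 0 ≤ s → 0 ≤ t → T (s + t) = (T s).comp (T t)
  tendsto_zero : ∀ x : X, Tendsto (fun t => T t x) (𝓝[>] 0) (𝓝 x)

/-- `A` is the infinitesimal generator of `T`: the domain of `A` consists of exactly those `x` for
which the right derivative of `T t x` at `t = 0` exists, and `A x` is this derivative. -/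
def IsGenerator (A : X →ₗ.[ℂ] X) (T : ℝ → X →L[ℂ] X) : Prop :=
  ∀ x y : X, (x, y) ∈ A.graph ↔
    Tendsto (fun h : ℝ => ((h⁻¹ : ℝ) : ℂ) • (T h x - x)) (𝓝[>] 0) (𝓝 y)

/-- `A` generates a strongly continuous semigroup `T` with `‖T t‖ ≤ c e^{-β t}`, `t ≥ 0`, for some
constants `c, β > 0`. -/
def GeneratesExpStable (A : X →ₗ.[ℂ] X) : Prop :=
  ∃ T : ℝ → X →L[ℂ] X, IsC0Semigroup T ∧ IsGenerator A T ∧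
    ∃ c β : ℝ, 0 < c ∧ 0 < β ∧ ∀ t : ℝ, 0 ≤ t → ‖T t‖ ≤ c * Real.exp (-(β * t))

end Semigroup

/-! ### The inverse of an operator on the orthogonal complement of its null-space -/

section PseudoInverse

variable {H : Type*} [NormedAddCommGroup H] [InnerProductSpace ℂ H]

/-- The null-space of a partially defined operator, as a subspace of the ambient space. -/
def nullSpace (B : H →ₗ.[ℂ] H) : Submodule ℂ H :=
  (LinearMap.ker B.toFun).map B.domain.subtype

/-- The graph of the inverse of the part of `B` in `(nullSpace B)ᗮ`: all pairs `(x, y)` with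
`x, y ∈ (nullSpace B)ᗮ`, `y ∈ D(B)` and `B y = x`. -/
def invGraph (B : H →ₗ.[ℂ] H) : Submodule ℂ ((nullSpace B)ᗮ × (nullSpace B)ᗮ) :=
  B.graph.comap
    ((((nullSpace B)ᗮ.subtype).comp (LinearMap.snd ℂ (nullSpace B)ᗮ (nullSpace B)ᗮ)).prod
      (((nullSpace B)ᗮ.subtype).comp (LinearMap.fst ℂ (nullSpace B)ᗮ (nullSpace B)ᗮ)))

theorem mem_invGraph (B : H →ₗ.[ℂ] H) (p : (nullSpace B)ᗮ × (nullSpace B)ᗮ) :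
    p ∈ invGraph B ↔ ((p.2 : H), (p.1 : H)) ∈ B.graph := Iff.rfl

theorem invGraph_functional (B : H →ₗ.[ℂ] H) (p : (nullSpace B)ᗮ × (nullSpace B)ᗮ)
    (hp : p ∈ invGraph B) (hp1 : p.1 = 0) : p.2 = 0 := by
  rw [mem_invGraph, LinearPMap.mem_graph_iff] at hp
  obtain ⟨z, hz1, hz2⟩ := hp
  have hmem : (p.2 : H) ∈ nullSpace B :=
    ⟨z, by simpa [hp1] using hz2, hz1⟩
  have h0 : ⟪(p.2 : H), (p.2 : H)⟫_ℂ = 0 :=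
    (Submodule.mem_orthogonal _ _).1 p.2.2 _ hmem
  exact Subtype.ext (inner_self_eq_zero.1 h0)

/-- The inverse of the part of `B` in the Hilbert space `(nullSpace B)ᗮ`. -/
def pseudoInverse (B : H →ₗ.[ℂ] H) : (nullSpace B)ᗮ →ₗ.[ℂ] (nullSpace B)ᗮ :=
  (invGraph B).toLinearPMap

theorem mem_graph_pseudoInverse (B : H →ₗ.[ℂ] H) (x y : (nullSpace B)ᗮ) :
    (x, y) ∈ (pseudoInverse B).graph ↔ ((y : H), (x : H)) ∈ B.graph := by
  rw [pseudoInverse, Submodule.toLinearPMap_graph_eq _ (invGraph_functional B)]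
  exact mem_invGraph B (x, y)

end PseudoInverse

/-! ### The second order system `M ÿ + C ẏ + y = 0` -/

section System

variable {Y : Type*} [NormedAddCommGroup Y] [InnerProductSpace ℂ Y] [CompleteSpace Y]

/-- A (possibly unbounded) operator `M` on `Y` is selfadjoint and positive: `(M x, x) ≥ 0` for all
`x ∈ D(M)`. Selfadjointness includes that `D(M)` is dense. -/
def IsPositiveSelfAdjoint (M : Y →ₗ.[ℂ] Y) : Prop :=
  IsSelfAdjoint M ∧ ∀ x : M.domain, 0 ≤ (⟪M x, (x : Y)⟫_ℂ).re

/-- `S = M^{1/2}`: `S` is the (unique) positive selfadjoint operator with `S ∘ S = M`, where the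
composition has its natural domain. -/
def IsPositiveSqrt (S M : Y →ₗ.[ℂ] Y) : Prop :=
  IsPositiveSelfAdjoint S ∧
    ∀ x z : Y, (x, z) ∈ M.graph ↔ ∃ y : Y, (x, y) ∈ S.graph ∧ (y, z) ∈ S.graph

/-- For `S = M^{1/2}`, the operator matrix `A⁺ = [[-C, -M^{1/2}], [M^{1/2}, 0]]` on the Hilbert
space `Y ⊕ Y`, with domain `D(M^{1/2}) ⊕ D(M^{1/2})`. -/
def phaseInverse (S : Y →ₗ.[ℂ] Y) (C : Y →L[ℂ] Y) :
    WithLp 2 (Y × Y) →ₗ.[ℂ] WithLp 2 (Y × Y) where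
  domain :=
    { carrier := {p | p.fst ∈ S.domain ∧ p.snd ∈ S.domain}
      add_mem' := fun ha hb => ⟨S.domain.add_mem ha.1 hb.1, S.domain.add_mem ha.2 hb.2⟩
      zero_mem' := ⟨S.domain.zero_mem, S.domain.zero_mem⟩
      smul_mem' := fun c _ ha => ⟨S.domain.smul_mem c ha.1, S.domain.smul_mem c ha.2⟩ }
  toFun :=
    { toFun := fun p => WithLp.toLp 2
        (-(C p.1.fst) - S ⟨p.1.snd, p.2.2⟩, S ⟨p.1.fst, p.2.1⟩)
      map_add' := fun p q => by
        have h1 : S ⟨(p + q).1.fst, (p + q).2.1⟩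
            = S ⟨p.1.fst, p.2.1⟩ + S ⟨q.1.fst, q.2.1⟩ := (S.map_add _ _).symm ▸ rfl
        have h2 : S ⟨(p + q).1.snd, (p + q).2.2⟩
            = S ⟨p.1.snd, p.2.2⟩ + S ⟨q.1.snd, q.2.2⟩ := (S.map_add _ _).symm ▸ rfl
        have h3 : C (p + q).1.fst = C p.1.fst + C q.1.fst := C.map_add _ _
        rw [h1, h2, h3, ← WithLp.toLp_add]
        congr 1
        ext
        · simp only [Prod.fst_add]; abel
        · rfl
      map_smul' := fun c p => by
        have h1 : S ⟨(c • p).1.fst, (c • p).2.1⟩ = c • S ⟨p.1.fst, p.2.1⟩ :=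
          (S.map_smul _ _).symm ▸ rfl
        have h2 : S ⟨(c • p).1.snd, (c • p).2.2⟩ = c • S ⟨p.1.snd, p.2.2⟩ :=
          (S.map_smul _ _).symm ▸ rfl
        have h3 : C (c • p).1.fst = c • C p.1.fst := C.map_smul _ _
        rw [h1, h2, h3, RingHom.id_apply, ← WithLp.toLp_smul]
        congr 1
        ext
        · simp only [Prod.smul_fst, smul_sub, smul_neg]
        · rfl }

/-- The generator `A` of the second order system: the inverse of the part of `A⁺` in the physical
phase space, that is, in the orthogonal complement of the null-space of `A⁺`. -/
def phaseGenerator (S : Y →ₗ.[ℂ] Y) (C : Y →L[ℂ] Y) :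
    (nullSpace (phaseInverse S C))ᗮ →ₗ.[ℂ] (nullSpace (phaseInverse S C))ᗮ :=
  pseudoInverse (phaseInverse S C)

/-- The system `M ÿ + C ẏ + y = 0` is exponentially stable: with `S = M^{1/2}`, its generator
generates an exponentially stable semigroup on the physical phase space. -/
def ExpStable (M : Y →ₗ.[ℂ] Y) (C : Y →L[ℂ] Y) : Prop :=
  ∃ S : Y →ₗ.[ℂ] Y, IsPositiveSqrt S M ∧ GeneratesExpStable (phaseGenerator S C)

end System

end DampedSystem

end

/-! The proof compares resolvents on the imaginary axis. Exponential stability puts `0` in the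
resolvent set of the generator, so each vector of the phase space lies in the domain of the phase
operator. This makes `M^{1/2}` everywhere defined, hence bounded by Hellinger–Toeplitz. The phase
operator is then a bounded dissipative `B = J - P`, with `J` skew and `P = diag(C, 0)`, and the
generator is the inverse of `B` off its kernel.

By a Gearhart–Prüss argument, stability is equivalent to `‖B y‖ ≤ K ‖iω B y - y‖` for all real `ω`
and all `y`. This inequality makes sense even if `B` has a kernel. Necessity integrates `e^{-iωt}
T(t) x` over the half-line. For sufficiency, the Yosida approximations `(B - ε)⁻¹` are bounded,
dissipative and satisfy resolvent bounds uniform for `0 < ε ≤ 1`. Plancherel's theorem applied to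
truncated orbits gives decay with constants independent of `ε`, and this decay survives the strong
limit.

The heart is `ResolventBound.of_comparable`, which replaces `P` by a comparable `Q`. The second
resolvent identity leaves the cross terms `⟪w, P y⟫` and `⟪w, Q y⟫`, where `w` solves an adjoint
equation for `J - P` and `y` belongs to `J - Q`. Cauchy–Schwarz for the forms reduces them to `⟪P w,
w⟫` and `⟪Q y, y⟫`, which dissipation controls. Comparability is used to pass between the two forms.
-/

noncomputable section

namespace DampedSystem

open scoped InnerProduct

/-! ### Dissipative bounded operators -/

section Dissipative

variable {H : Type*} [NormedAddCommGroup H] [InnerProductSpace ℂ H]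

/-- A bounded operator is dissipative if its numerical range lies in the closed left half-plane. -/
def IsDissipative (B : H →L[ℂ] H) : Prop := ∀ x, (⟪B x, x⟫_ℂ).re ≤ 0

/-- A uniform bound for the resolvent of `B⁻¹` on the imaginary axis, expressed through `B`. -/
def ResolventBound (B : H →L[ℂ] H) (K : ℝ) : Prop :=
  ∀ (ω : ℝ) (y : H), ‖B y‖ ≤ K * ‖((ω : ℂ) * Complex.I) • B y - y‖

theorem re_inner_comm (x y : H) : (⟪x, y⟫_ℂ).re = (⟪y, x⟫_ℂ).re :=
  inner_re_symm (𝕜 := ℂ) x y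

theorem re_inner_smul_I_self (ω : ℝ) (x : H) : (⟪x, ((ω : ℂ) * Complex.I) • x⟫_ℂ).re = 0 := by
  rw [inner_smul_right, inner_self_eq_norm_sq_to_K]
  simp only [Complex.coe_algebraMap, ← Complex.ofReal_pow, Complex.re_mul_ofReal]
  simp

theorem eq_zero_of_quadratic_nonpos {a b : ℝ} (h : ∀ s : ℝ, s * a + s ^ 2 * b ≤ 0) : a = 0 := by
  by_contra ha
  have hb : b ≤ -1 ∨ -1 < b := le_or_gt _ _
  -- For small `s` of the sign of `a` the linear term wins; this `s` is small enough because `1 + b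
  -- + b² > 0`.
  have h1 := h (a / (1 + b ^ 2))
  have hp : 0 < 1 + b ^ 2 := by positivity
  have : a / (1 + b ^ 2) * a + (a / (1 + b ^ 2)) ^ 2 * b
      = a ^ 2 * (1 + b ^ 2 + b) / (1 + b ^ 2) ^ 2 := by field_simp
  rw [this] at h1
  have h2 : 0 < a ^ 2 * (1 + b ^ 2 + b) / (1 + b ^ 2) ^ 2 := by
    have : 0 < a ^ 2 := by positivity
    have : 0 < 1 + b ^ 2 + b := by nlinarith [sq_nonneg (b + 1 / 2)]
    positivity
  linarith

/-- The range of a dissipative operator is orthogonal to its kernel. -/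
theorem IsDissipative.inner_apply_eq_zero {B : H →L[ℂ] H} (hB : IsDissipative B) {y : H}
    (hy : B y = 0) (z : H) : ⟪B z, y⟫_ℂ = 0 := by
  have key : ∀ z : H, (⟪B z, y⟫_ℂ).re = 0 := fun z => by
    apply eq_zero_of_quadratic_nonpos (b := (⟪B z, z⟫_ℂ).re)
    intro s
    have := hB (y + (s : ℂ) • z)
    simp only [map_add, hy, map_smul, zero_add, inner_add_right, inner_smul_left, inner_smul_right,
      Complex.conj_ofReal, Complex.add_re, Complex.re_ofReal_mul] at this
    linarith
  apply Complex.ext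
  · exact key z
  · have := key (Complex.I • z)
    simpa [inner_smul_left] using this

variable [CompleteSpace H]

theorem IsDissipative.adjoint {B : H →L[ℂ] H} (hB : IsDissipative B) : IsDissipative (B†) := fun x => by
  rw [ContinuousLinearMap.adjoint_inner_left, re_inner_comm]
  exact hB x

/-- The lower bound makes `G† G` coercive, so `G†` is onto. If `G† w = 0`, dissipativity of `G†`
makes its whole range orthogonal to `w`; testing with `G† (G w)` gives `G w = 0`, hence `w = 0`.
Thus `G†` is bijective. -/
theorem IsDissipative.isUnit_of_antilipschitz {G : H →L[ℂ] H} (hG : IsDissipative G) {c : ℝ}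
    (hc : 0 < c) (h : ∀ x, c * ‖x‖ ≤ ‖G x‖) : IsUnit G := by
  have hU : IsUnit (G† * G) := by
    refine ContinuousLinearMap.isUnit_of_forall_le_norm_inner_map _
      (c := ⟨c ^ 2, by positivity⟩) (by exact_mod_cast (by positivity : 0 < c ^ 2)) fun x => ?_
    rw [mul_apply_eq_comp, ContinuousLinearMap.adjoint_inner_left,
      inner_self_eq_norm_sq_to_K]
    have h1 : (c * ‖x‖) ^ 2 ≤ ‖G x‖ ^ 2 := pow_le_pow_left₀ (by positivity) (h x) 2
    simp only [Complex.coe_algebraMap, norm_pow, Complex.norm_real, norm_norm]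
    calc _ = (c * ‖x‖) ^ 2 := by change ‖x‖ ^ 2 * c ^ 2 = _; ring
      _ ≤ _ := h1
  have hinj : ∀ w, (G†) w = 0 → w = 0 := fun w hw => by
    have h0 : ∀ z, ⟪(G†) z, w⟫_ℂ = 0 := hG.adjoint.inner_apply_eq_zero hw
    have hGw : G w = 0 := by
      rw [← inner_self_eq_zero (𝕜 := ℂ), ← ContinuousLinearMap.adjoint_inner_left]
      exact h0 _
    have := h w
    rw [hGw, norm_zero] at this
    exact norm_le_zero_iff.1 (by nlinarith [norm_nonneg w])
  have hbij : Function.Bijective (G†) := by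
    refine ⟨(injective_iff_map_eq_zero _).2 hinj, fun y => ?_⟩
    obtain ⟨V, hV⟩ := hU.exists_right_inv
    refine ⟨G (V y), ?_⟩
    exact DFunLike.congr_fun hV y
  have hadj : IsUnit (G†) := ContinuousLinearMap.isUnit_iff_bijective.2 hbij
  have := hadj.star
  rwa [ContinuousLinearMap.star_eq_adjoint, ContinuousLinearMap.adjoint_adjoint] at this

/-- Dividing by `iω` turns the operator into `B - (iω)⁻¹`, still dissipative because the shift is
imaginary. The resolvent bound supplies the lower bound. -/
theorem ResolventBound.isUnit {B : H →L[ℂ] H} (hB : IsDissipative B) {K : ℝ} (hK : 0 ≤ K)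
    (h : ResolventBound B K) (ω : ℝ) : IsUnit (((ω : ℂ) * Complex.I) • B - 1) := by
  rcases eq_or_ne ω 0 with rfl | hω
  · simp
  set F := ((ω : ℂ) * Complex.I) • B - 1 with hF
  have hne : ((ω : ℂ) * Complex.I) ≠ 0 := by simp [hω]
  have hG : IsDissipative (((ω : ℂ) * Complex.I)⁻¹ • F) := fun x => by
    have : (((ω : ℂ) * Complex.I)⁻¹ • F) x = B x - ((ω : ℂ) * Complex.I)⁻¹ • x := by
      simp only [hF, smul_apply, sub_apply, smul_sub,
        smul_smul, inv_mul_cancel₀ hne, one_smul, one_apply_eq_self]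
    rw [this, inner_sub_left, inner_smul_left, inner_self_eq_norm_sq_to_K, Complex.sub_re]
    have h2 : ((starRingEnd ℂ) ((ω : ℂ) * Complex.I)⁻¹ * ((‖x‖ : ℂ)) ^ 2).re = 0 := by
      rw [← Complex.ofReal_pow, Complex.re_mul_ofReal]
      simp
    have := hB x
    simp only [Complex.coe_algebraMap] at *
    linarith
  have hlow : ∀ x, (|ω| * K + 1)⁻¹ * ‖x‖ ≤ ‖F x‖ := fun x => by
    rw [inv_mul_le_iff₀ (by positivity)]
    have h1 := h ω x
    have h3 : F x = ((ω : ℂ) * Complex.I) • B x - x := rfl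
    rw [← h3] at h1
    calc ‖x‖ = ‖((ω : ℂ) * Complex.I) • B x - F x‖ := by rw [h3]; congr 1; abel
      _ ≤ ‖((ω : ℂ) * Complex.I) • B x‖ + ‖F x‖ := norm_sub_le _ _
      _ = |ω| * ‖B x‖ + ‖F x‖ := by simp [norm_smul]
      _ ≤ |ω| * (K * ‖F x‖) + ‖F x‖ := by gcongr
      _ = _ := by ring
  have hu := hG.isUnit_of_antilipschitz (c := |ω|⁻¹ * (|ω| * K + 1)⁻¹) (by positivity) fun x => by
    rw [smul_apply, norm_smul, mul_assoc]
    have : ‖((ω : ℂ) * Complex.I)⁻¹‖ = |ω|⁻¹ := by simp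
    rw [this]
    gcongr
    exact hlow x
  have := hu.smul (Units.mk0 _ hne)
  rwa [Units.smul_def, smul_smul, Units.val_mk0, mul_inv_cancel₀ hne, one_smul] at this

end Dissipative

/-! ### Comparison of two dampings -/

section Comparison

variable {H : Type*} [NormedAddCommGroup H] [InnerProductSpace ℂ H]

theorem isDissipative_sub {J P : H →L[ℂ] H} (hJ : ∀ x y, ⟪J x, y⟫_ℂ = -⟪x, J y⟫_ℂ)
    (hP : P.IsPositive) : IsDissipative (J - P) := fun x => by
  have h1 : (⟪J x, x⟫_ℂ).re = 0 := by
    have := congrArg Complex.re (hJ x x)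
    rw [Complex.neg_re, re_inner_comm x (J x)] at this
    linarith
  have h2 := hP.re_inner_nonneg_left x
  simp only [RCLike.re_eq_complex_re] at h2
  rw [sub_apply, inner_sub_left, Complex.sub_re]
  linarith

theorem re_inner_sub_apply {J P : H →L[ℂ] H} (hJ : ∀ x y, ⟪J x, y⟫_ℂ = -⟪x, J y⟫_ℂ) (x : H) :
    (⟪(J - P) x, x⟫_ℂ).re = -(⟪P x, x⟫_ℂ).re := by
  have h1 : (⟪J x, x⟫_ℂ).re = 0 := by
    have := congrArg Complex.re (hJ x x)
    rw [Complex.neg_re, re_inner_comm x (J x)] at this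
    linarith
  rw [sub_apply, inner_sub_left, Complex.sub_re]
  linarith

variable [CompleteSpace H]

/-- Cauchy–Schwarz for the form of `P`, obtained by writing `P` as the square of its positive root.
-/
theorem norm_inner_sq_le_of_isPositive {P : H →L[ℂ] H} (hP : P.IsPositive) (x y : H) :
    ‖⟪x, P y⟫_ℂ‖ ^ 2 ≤ (⟪P x, x⟫_ℂ).re * (⟪P y, y⟫_ℂ).re := by
  have hP0 : 0 ≤ P := (ContinuousLinearMap.nonneg_iff_isPositive P).2 hP
  set R := CFC.sqrt P
  have hR : R * R = P := CFC.sqrt_mul_sqrt_self P hP0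
  have hRs : R† = R := ((CFC.sqrt_nonneg P).isSelfAdjoint)
  have h1 : ∀ u v, ⟪u, P v⟫_ℂ = ⟪R u, R v⟫_ℂ := fun u v => by
    rw [← hR, mul_apply_eq_comp, ← ContinuousLinearMap.adjoint_inner_left, hRs]
  have h2 : ∀ u, (⟪P u, u⟫_ℂ).re = ‖R u‖ ^ 2 := fun u => by
    rw [re_inner_comm, h1, inner_self_eq_norm_sq_to_K]
    simp [← Complex.ofReal_pow]
  rw [h1, h2, h2, ← mul_pow]
  exact pow_le_pow_left₀ (norm_nonneg _) (norm_inner_le_norm _ _) 2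

/-- The hypothesis says `‖B F⁻¹‖ ≤ K` with `F = iωB - 1`; since `B` and `F` commute, taking adjoints
yields the same bound for `B†` and `F†`. The proof pairs `B† w = F x` with itself and moves `F`
across `B`. -/
theorem ResolventBound.adjoint_le {B : H →L[ℂ] H} (hB : IsDissipative B) {K : ℝ} (hK : 0 ≤ K)
    (h : ResolventBound B K) (ω : ℝ) (w : H) :
    ‖(B†) w‖ ≤ K * ‖((((ω : ℂ) * Complex.I) • B - 1)†) w‖ := by
  set F := ((ω : ℂ) * Complex.I) • B - 1 with hF
  obtain ⟨x, hx⟩ := (ContinuousLinearMap.isUnit_iff_bijective.1 (h.isUnit hB hK ω)).2 ((B†) w)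
  have hcomm : B (F x) = F (B x) := by simp [hF]
  have h1 : ⟪(B†) w, (B†) w⟫_ℂ = ⟪(F†) w, B x⟫_ℂ := by
    conv_lhs => rw [← hx]
    rw [hx, ContinuousLinearMap.adjoint_inner_left, ContinuousLinearMap.adjoint_inner_left,
      ← hcomm, hx]
  have h2 : ‖(B†) w‖ ^ 2 ≤ ‖(F†) w‖ * ‖B x‖ := by
    have := norm_inner_le_norm (𝕜 := ℂ) ((F†) w) (B x)
    rw [← h1, inner_self_eq_norm_sq_to_K] at this
    simpa using this
  have h3 : ‖B x‖ ≤ K * ‖(B†) w‖ := by rw [← hx]; exact h ω x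
  rcases (norm_nonneg ((B†) w)).eq_or_lt with h0 | h0
  · rw [← h0]; positivity
  · have : ‖(B†) w‖ * ‖(B†) w‖ ≤ (K * ‖(F†) w‖) * ‖(B†) w‖ := by
      calc _ = ‖(B†) w‖ ^ 2 := by ring
        _ ≤ ‖(F†) w‖ * (K * ‖(B†) w‖) := h2.trans (by gcongr)
        _ = _ := by ring
    exact le_of_mul_le_mul_right this h0

/-- Mutually dominated dampings have uniformly bounded resolvents simultaneously. -/
theorem ResolventBound.of_comparable {J P Q : H →L[ℂ] H} (hJ : ∀ x y, ⟪J x, y⟫_ℂ = -⟪x, J y⟫_ℂ)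
    (hP : P.IsPositive) (hQ : Q.IsPositive) {a K : ℝ} (ha : 0 ≤ a) (hK : 0 ≤ K)
    (hPQ : ∀ x, (⟪P x, x⟫_ℂ).re ≤ a * (⟪Q x, x⟫_ℂ).re)
    (hQP : ∀ x, (⟪Q x, x⟫_ℂ).re ≤ a * (⟪P x, x⟫_ℂ).re)
    (h : ResolventBound (J - P) K) : ResolventBound (J - Q) (2 * K + 4 * a * K) := by
  intro ω y
  have hB := isDissipative_sub hJ hP
  set B := J - P with hBdef
  set F := ((ω : ℂ) * Complex.I) • B - 1 with hF
  set f := (J - Q) y with hf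
  set g := ((ω : ℂ) * Complex.I) • f - y with hg
  -- With this dual vector `‖f‖² = ⟪w, F f⟫`, and `F f` involves only `B g` and the difference of
  -- the dampings at `y`.
  obtain ⟨w, hw⟩ : ∃ w, (F†) w = f := by
    have hu := (h.isUnit hB hK ω).star
    rw [ContinuousLinearMap.star_eq_adjoint] at hu
    exact (ContinuousLinearMap.isUnit_iff_bijective.1 hu).2 f
  have hBw : ‖(B†) w‖ ≤ K * ‖f‖ := by
    have := h.adjoint_le hB hK ω w
    rwa [← hF, hw] at this
  -- Energy identity for the adjoint equation: the term with `iω` is purely imaginary and the skew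
  -- part drops out, leaving the damping.
  have hPw0 : (⟪P w, w⟫_ℂ).re = (⟪(B†) w, f⟫_ℂ).re := by
    have e1 : (F†) w = -((ω : ℂ) * Complex.I) • (B†) w - w := by
      have : (F†) = -((ω : ℂ) * Complex.I) • (B†) - 1 := by
        rw [hF, ← ContinuousLinearMap.star_eq_adjoint, ← ContinuousLinearMap.star_eq_adjoint,
          star_sub, star_smul, star_one]
        simp
      rw [this]
      rfl
    have e2 := re_inner_smul_I_self (-ω) ((B†) w)
    rw [Complex.ofReal_neg, neg_mul] at e2
    rw [← hw, e1, inner_sub_right, Complex.sub_re, e2, ContinuousLinearMap.adjoint_inner_left,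
      re_inner_comm w, re_inner_sub_apply hJ]
    ring
  have hPw : (⟪P w, w⟫_ℂ).re ≤ K * ‖f‖ ^ 2 := by
    rw [hPw0]
    calc _ ≤ ‖(B†) w‖ * ‖f‖ := (Complex.re_le_norm _).trans (norm_inner_le_norm _ _)
      _ ≤ K * ‖f‖ * ‖f‖ := by gcongr
      _ = _ := by ring
  have hQy : (⟪Q y, y⟫_ℂ).re ≤ ‖f‖ * ‖g‖ := by
    have : (⟪Q y, y⟫_ℂ).re = (⟪f, g⟫_ℂ).re := by
      rw [hg, inner_sub_right, Complex.sub_re, re_inner_smul_I_self, hf, re_inner_sub_apply hJ]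
      ring
    rw [this]
    exact (Complex.re_le_norm _).trans (norm_inner_le_norm _ _)
  have hFf : F f = B g - (P y - Q y) := by
    have e2 : f = B y + (P y - Q y) := by simp [hf, hBdef]
    have e3 : B g = ((ω : ℂ) * Complex.I) • B f - B y := by simp [hg]
    rw [e3]
    have e4 : F f = ((ω : ℂ) * Complex.I) • B f - f := rfl
    rw [e4]
    nth_rewrite 2 [e2]
    abel
  have hkey : ‖f‖ ^ 2 ≤ ‖(B†) w‖ * ‖g‖ + ‖⟪w, P y⟫_ℂ‖ + ‖⟪w, Q y⟫_ℂ‖ := by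
    have e5 : ⟪f, f⟫_ℂ = ⟪(B†) w, g⟫_ℂ - (⟪w, P y⟫_ℂ - ⟪w, Q y⟫_ℂ) := by
      have e7 : ⟪f, f⟫_ℂ = ⟪(F†) w, f⟫_ℂ := by rw [hw]
      rw [e7, ContinuousLinearMap.adjoint_inner_left, hFf, inner_sub_right, inner_sub_right,
        ContinuousLinearMap.adjoint_inner_left]
    have e6 : ‖f‖ ^ 2 = ‖⟪f, f⟫_ℂ‖ := by rw [inner_self_eq_norm_sq_to_K]; simp
    rw [e6, e5]
    have := norm_inner_le_norm (𝕜 := ℂ) ((B†) w) g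
    linarith [norm_sub_le (⟪(B†) w, g⟫_ℂ) (⟪w, P y⟫_ℂ - ⟪w, Q y⟫_ℂ),
      norm_sub_le (⟪w, P y⟫_ℂ) (⟪w, Q y⟫_ℂ)]
  have hpos : ∀ {R : H →L[ℂ] H}, R.IsPositive → ∀ x, 0 ≤ (⟪R x, x⟫_ℂ).re :=
    fun hR x => hR.re_inner_nonneg_left x
  set r := Real.sqrt (a * K * ‖f‖ ^ 2 * (‖f‖ * ‖g‖)) with hr
  have hPterm : ‖⟪w, P y⟫_ℂ‖ ≤ r := by
    refine Real.le_sqrt_of_sq_le ((norm_inner_sq_le_of_isPositive hP w y).trans ?_)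
    calc _ ≤ (K * ‖f‖ ^ 2) * (a * (‖f‖ * ‖g‖)) :=
          mul_le_mul hPw ((hPQ y).trans (by gcongr)) (hpos hP y) (by positivity)
      _ = _ := by ring
  have hQterm : ‖⟪w, Q y⟫_ℂ‖ ≤ r := by
    refine Real.le_sqrt_of_sq_le ((norm_inner_sq_le_of_isPositive hQ w y).trans ?_)
    calc _ ≤ (a * (K * ‖f‖ ^ 2)) * (‖f‖ * ‖g‖) :=
          mul_le_mul ((hQP w).trans (by gcongr)) hQy (hpos hQ y) (by positivity)
      _ = _ := by ring
  change ‖f‖ ≤ (2 * K + 4 * a * K) * ‖g‖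
  rcases (norm_nonneg f).eq_or_lt with h0 | h0
  · rw [← h0]; positivity
  -- This is `√(uv) ≤ u/4 + v`. The weight `1/4` lets the two cross terms contribute only `‖f‖²/2`,
  -- which is absorbed on the left and doubles the remaining constants.
  have hr' : r ≤ ‖f‖ * (‖f‖ / 4 + a * K * ‖g‖) := by
    rw [hr]
    apply Real.sqrt_le_iff.2 ⟨by positivity, ?_⟩
    have : 0 ≤ ‖f‖ ^ 2 * (‖f‖ / 4 - a * K * ‖g‖) ^ 2 := by positivity
    nlinarith
  have hfin : ‖f‖ * ‖f‖ ≤ ‖f‖ * (K * ‖g‖ + 2 * (‖f‖ / 4 + a * K * ‖g‖)) := by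
    calc ‖f‖ * ‖f‖ = ‖f‖ ^ 2 := by ring
      _ ≤ (K * ‖f‖) * ‖g‖ + r + r := hkey.trans (by gcongr)
      _ ≤ (K * ‖f‖) * ‖g‖ + ‖f‖ * (‖f‖ / 4 + a * K * ‖g‖) + ‖f‖ * (‖f‖ / 4 + a * K * ‖g‖) := by
          gcongr
      _ = _ := by ring
  have := le_of_mul_le_mul_left hfin h0
  linarith

end Comparison

/-! ### Uniform decay of the semigroup of a bounded dissipative operator -/

section BoundedGenerator

open MeasureTheory NormedSpace
open scoped FourierTransform SchwartzMap ContDiff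

variable {X : Type*} [NormedAddCommGroup X] [InnerProductSpace ℂ X]

theorem integrable_norm_sq (v : 𝓢(ℝ, X)) : Integrable fun t => ‖v t‖ ^ 2 :=
  (v.memLp 2 volume).integrable_norm_pow two_ne_zero

variable [CompleteSpace X]

theorem hasDerivAt_exp_smul_apply (A : X →L[ℂ] X) (x : X) (t : ℝ) :
    HasDerivAt (fun t : ℝ => exp (t • A) x) (A (exp (t • A) x)) t := by
  have h := hasDerivAt_exp_smul_const' (𝕂 := ℝ) A t
  have := (((ContinuousLinearMap.apply ℂ X x).restrictScalars ℝ).hasFDerivAt).comp_hasDerivAt t h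
  exact this

theorem contDiff_exp_smul_apply (A : X →L[ℂ] X) (x : X) :
    ContDiff ℝ ∞ (fun t : ℝ => exp (t • A) x) := by
  rw [contDiff_infty]
  intro n
  induction n with
  | zero =>
    exact contDiff_zero.2 (continuous_iff_continuousAt.2 fun t =>
      (hasDerivAt_exp_smul_apply A x t).continuousAt)
  | succ n ih =>
    have hd : deriv (fun t : ℝ => exp (t • A) x) = fun t => A (exp (t • A) x) :=
      funext fun t => (hasDerivAt_exp_smul_apply A x t).deriv
    rw [Nat.cast_add, Nat.cast_one, contDiff_succ_iff_deriv, hd]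
    refine ⟨fun t => (hasDerivAt_exp_smul_apply A x t).differentiableAt, by simp, ?_⟩
    exact (A.restrictScalars ℝ).contDiff.comp ih

/-- The derivative of the squared norm is twice the real part of `⟪A u, u⟫`, which is nonpositive.
-/
theorem antitone_norm_exp_smul_apply {A : X →L[ℂ] X} (hA : IsDissipative A) (x : X) :
    Antitone fun t : ℝ => ‖exp (t • A) x‖ := by
  have h2 : Antitone fun t : ℝ => ‖exp (t • A) x‖ ^ 2 := by
    let := InnerProductSpace.rclikeToReal ℂ X
    have hd := fun t : ℝ => (hasDerivAt_exp_smul_apply A x t).norm_sq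
    refine antitone_of_deriv_nonpos (fun t => (hd t).differentiableAt) fun t => ?_
    rw [(hd t).deriv, real_inner_eq_re_inner ℂ, RCLike.re_eq_complex_re, re_inner_comm]
    linarith [hA (exp (t • A) x)]
  intro s t hst
  exact (pow_le_pow_iff_left₀ (norm_nonneg _) (norm_nonneg _) two_ne_zero).1 (h2 hst)

theorem norm_exp_smul_apply_le {A : X →L[ℂ] X} (hA : IsDissipative A) {t : ℝ} (ht : 0 ≤ t)
    (x : X) : ‖exp (t • A) x‖ ≤ ‖x‖ := by
  simpa using antitone_norm_exp_smul_apply hA x ht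

/-- Plancherel's theorem turns a resolvent bound on the imaginary axis into an `L²` estimate for
the inhomogeneous equation. -/
theorem integral_norm_sq_le_of_resolvent {A : X →L[ℂ] X} {K : ℝ}
    (h : ∀ (τ : ℝ) (x : X), ‖x‖ ≤ K * ‖((τ : ℂ) * Complex.I) • x - A x‖) (v : 𝓢(ℝ, X)) :
    ∫ t, ‖v t‖ ^ 2 ≤ K ^ 2 * ∫ t, ‖deriv v t - A (v t)‖ ^ 2 := by
  set w : 𝓢(ℝ, X) := SchwartzMap.derivCLM ℂ X v - v.postcompCLM A with hw
  have hwt : ∀ t, w t = deriv v t - A (v t) := fun t => rfl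
  have hint : ∀ u : 𝓢(ℝ, X), Integrable u := fun u => u.integrable
  -- In this normalisation differentiation becomes multiplication by `2πiξ`, so the resolvent bound
  -- is used at `τ = 2πξ`.
  have hF : ∀ ξ : ℝ, 𝓕 w ξ = (((2 * Real.pi * ξ : ℝ) : ℂ) * Complex.I) • 𝓕 v ξ - A (𝓕 v ξ) := by
    intro ξ
    have e1 : 𝓕 w = 𝓕 (SchwartzMap.derivCLM ℂ X v) - 𝓕 (v.postcompCLM A) :=
      map_sub (SchwartzMap.fourierTransformCLM ℂ) _ _
    have e2 : 𝓕 (SchwartzMap.derivCLM ℂ X v) ξ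
        = (((2 * Real.pi * ξ : ℝ) : ℂ) * Complex.I) • 𝓕 v ξ := by
      have := congrFun (Real.fourier_deriv (hint v) v.differentiable
        (hint (SchwartzMap.derivCLM ℂ X v))) ξ
      rw [SchwartzMap.fourier_coe, SchwartzMap.fourier_coe]
      refine (this.trans ?_)
      congr 1
      push_cast
      ring
    have e3 : 𝓕 (v.postcompCLM A) ξ = A (𝓕 v ξ) := by
      rw [SchwartzMap.fourier_coe, SchwartzMap.fourier_coe, Real.fourier_eq, Real.fourier_eq,
        ← A.integral_comp_comm ((Real.fourierIntegral_convergent_iff ξ).2 (hint v))]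
      refine integral_congr_ae (Eventually.of_forall fun t => ?_)
      simp [Circle.smul_def]
    rw [e1, sub_apply, e2, e3]
  simp_rw [← hwt]
  rw [← SchwartzMap.integral_norm_sq_fourier v, ← SchwartzMap.integral_norm_sq_fourier w,
    ← integral_const_mul]
  refine integral_mono (integrable_norm_sq _) ((integrable_norm_sq _).const_mul _) fun ξ => ?_
  have := h (2 * Real.pi * ξ) (𝓕 v ξ)
  rw [← hF ξ] at this
  simpa only [mul_pow] using pow_le_pow_left₀ (norm_nonneg _) this 2

theorem deriv_smoothTransition_of_lt {t : ℝ} (ht : t < 0) : deriv Real.smoothTransition t = 0 := by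
  have : Real.smoothTransition =ᶠ[𝓝 t] fun _ => 0 := by
    filter_upwards [Iio_mem_nhds ht] with s hs using Real.smoothTransition.zero_of_nonpos hs.le
  rw [this.deriv_eq, deriv_const]

theorem deriv_smoothTransition_of_gt {t : ℝ} (ht : 1 < t) : deriv Real.smoothTransition t = 0 := by
  have : Real.smoothTransition =ᶠ[𝓝 t] fun _ => 1 := by
    filter_upwards [Ioi_mem_nhds ht] with s hs using Real.smoothTransition.one_of_one_le hs.le
  rw [this.deriv_eq, deriv_const]

/-- The indicator form makes the squared truncation error integrable with a bound independent of the
length of the time interval. -/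
theorem exists_abs_deriv_smoothTransition_le :
    ∃ c : ℝ, 0 ≤ c ∧ ∀ t,
      |deriv Real.smoothTransition t| ≤ (Set.Icc (0 : ℝ) 1).indicator (fun _ => c) t := by
  have hc : Continuous (deriv Real.smoothTransition) :=
    (Real.smoothTransition.contDiff (n := 1)).continuous_deriv le_rfl
  obtain ⟨c, hc⟩ := isCompact_Icc.exists_bound_of_continuousOn (s := Set.Icc (0 : ℝ) 1)
    hc.continuousOn
  refine ⟨c, (norm_nonneg _).trans (hc 0 (by simp)), fun t => ?_⟩
  by_cases ht : t ∈ Set.Icc (0 : ℝ) 1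
  · rw [Set.indicator_of_mem ht]; exact hc t ht
  · rw [Set.indicator_of_notMem ht]
    rw [Set.mem_Icc, not_and_or, not_le, not_le] at ht
    rcases ht with ht | ht
    · simp [deriv_smoothTransition_of_lt ht]
    · simp [deriv_smoothTransition_of_gt ht]

/-- A quantitative Gearhart–Prüss theorem for bounded dissipative operators, with constants that do
not depend on the norm of the operator. -/
theorem exists_decay_const (X : Type*) [NormedAddCommGroup X] [InnerProductSpace ℂ X]
    [CompleteSpace X] : ∃ c : ℝ, 0 ≤ c ∧ ∀ (A : X →L[ℂ] X) (K T : ℝ), IsDissipative A →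
      2 ≤ T → (∀ (τ : ℝ) (x : X), ‖x‖ ≤ K * ‖((τ : ℂ) * Complex.I) • x - A x‖) →
      ∀ x : X, (T - 2) * ‖exp (T • A) x‖ ^ 2 ≤ c * K ^ 2 * ‖x‖ ^ 2 := by
  obtain ⟨c, hc0, hc⟩ := exists_abs_deriv_smoothTransition_le
  refine ⟨4 * c ^ 2, by positivity, fun A K T hA hT h x => ?_⟩
  set u : ℝ → X := fun t => exp (t • A) x with hu
  set s := Real.smoothTransition with hs
  -- A cutoff equal to `1` on `[1, T - 1]` and vanishing off `[0, T]`. The truncated orbit `v = φ u`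
  -- satisfies `v' - A v = φ' u`, which lives on two unit intervals.
  set φ : ℝ → ℝ := fun t => s t * s (T - t) with hφ
  have hφc : ContDiff ℝ ∞ φ := Real.smoothTransition.contDiff.mul
    (Real.smoothTransition.contDiff.comp (contDiff_const.sub contDiff_id))
  have hφ0 : ∀ t, t ∉ Set.Icc 0 T → φ t = 0 := fun t ht => by
    rw [Set.mem_Icc, not_and_or, not_le, not_le] at ht
    rcases ht with ht | ht
    · simp [hφ, hs, Real.smoothTransition.zero_of_nonpos ht.le]
    · simp [hφ, hs, Real.smoothTransition.zero_of_nonpos (sub_nonpos.2 ht.le)]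
  have hvc : HasCompactSupport fun t => φ t • u t :=
    HasCompactSupport.intro isCompact_Icc fun t ht => by rw [hφ0 t ht, zero_smul]
  set v : 𝓢(ℝ, X) := hvc.toSchwartzMap (hφc.smul (contDiff_exp_smul_apply A x)) with hv
  have hvt : ∀ t, v t = φ t • u t := fun t => rfl
  have hs' : ∀ t, HasDerivAt s (deriv s t) t := fun t =>
    ((Real.smoothTransition.contDiff (n := 1)).differentiable one_ne_zero t).hasDerivAt
  have hφ' : ∀ t, HasDerivAt φ (deriv s t * s (T - t) - s t * deriv s (T - t)) t := fun t => by
    have h1 : HasDerivAt (fun t => s (T - t)) (-deriv s (T - t)) t := by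
      have := (hs' (T - t)).scomp t ((hasDerivAt_id t).const_sub T)
      rwa [neg_one_smul] at this
    refine ((hs' t).mul h1).congr_deriv ?_
    ring
  have hres : ∀ t, deriv v t - A (v t) = (deriv s t * s (T - t) - s t * deriv s (T - t)) • u t := by
    intro t
    have : HasDerivAt v _ t := (hφ' t).smul (hasDerivAt_exp_smul_apply A x t)
    rw [this.deriv, hvt]
    have : A (φ t • u t) = φ t • A (u t) := (A.restrictScalars ℝ).map_smul _ _
    rw [this]
    simp [hu]
  have hmono := antitone_norm_exp_smul_apply hA x
  set M : ℝ := c ^ 2 * ‖x‖ ^ 2 with hM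
  have hupper : ∫ t, ‖deriv v t - A (v t)‖ ^ 2 ≤ 4 * M := by
    have hb : ∀ t, ‖deriv v t - A (v t)‖ ^ 2
        ≤ (Set.Icc (0 : ℝ) 1).indicator (fun _ => 2 * M) t
          + (Set.Icc (T - 1) T).indicator (fun _ => 2 * M) t := by
      intro t
      rw [hres, norm_smul, mul_pow, Real.norm_eq_abs, sq_abs]
      have ha := hc t
      have hb := hc (T - t)
      have hmem : T - t ∈ Set.Icc (0 : ℝ) 1 ↔ t ∈ Set.Icc (T - 1) T := by
        simp only [Set.mem_Icc]
        constructor <;> rintro ⟨h1, h2⟩ <;> constructor <;> linarith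
      have hu1 : 0 ≤ t → ‖u t‖ ^ 2 ≤ ‖x‖ ^ 2 := fun ht =>
        pow_le_pow_left₀ (norm_nonneg _) (norm_exp_smul_apply_le hA ht x) 2
      have hcoef : (deriv s t * s (T - t) - s t * deriv s (T - t)) ^ 2
          ≤ 2 * |deriv s t| ^ 2 + 2 * |deriv s (T - t)| ^ 2 := by
        have h1 : |deriv s t * s (T - t)| ≤ |deriv s t| := by
          rw [abs_mul, abs_of_nonneg (Real.smoothTransition.nonneg _)]
          exact mul_le_of_le_one_right (abs_nonneg _) (Real.smoothTransition.le_one _)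
        have h2 : |s t * deriv s (T - t)| ≤ |deriv s (T - t)| := by
          rw [abs_mul, abs_of_nonneg (Real.smoothTransition.nonneg _)]
          exact mul_le_of_le_one_left (abs_nonneg _) (Real.smoothTransition.le_one _)
        have h3 := pow_le_pow_left₀ (abs_nonneg _) h1 2
        have h4 := pow_le_pow_left₀ (abs_nonneg _) h2 2
        rw [sq_abs] at h3 h4
        nlinarith [sq_nonneg (deriv s t * s (T - t) + s t * deriv s (T - t))]
      have key : ∀ (I : Set ℝ) (r : ℝ), I ⊆ Set.Ici 0 → |r| ≤ I.indicator (fun _ => c) t →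
          2 * |r| ^ 2 * ‖u t‖ ^ 2 ≤ I.indicator (fun _ => 2 * M) t := by
        intro I r hI hr
        by_cases ht : t ∈ I
        · rw [Set.indicator_of_mem ht] at hr ⊢
          calc _ ≤ 2 * c ^ 2 * ‖x‖ ^ 2 := by
                gcongr
                exact norm_exp_smul_apply_le hA (hI ht) x
            _ = _ := by rw [hM]; ring
        · rw [Set.indicator_of_notMem ht] at hr ⊢
          have : |r| = 0 := le_antisymm hr (abs_nonneg _)
          simp [this]
      have hb' : |deriv s (T - t)| ≤ (Set.Icc (T - 1) T).indicator (fun _ => c) t := by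
        refine hb.trans_eq ?_
        by_cases ht : t ∈ Set.Icc (T - 1) T
        · rw [Set.indicator_of_mem ht, Set.indicator_of_mem (hmem.2 ht)]
        · rw [Set.indicator_of_notMem ht, Set.indicator_of_notMem (mt hmem.1 ht)]
      calc _ ≤ (2 * |deriv s t| ^ 2 + 2 * |deriv s (T - t)| ^ 2) * ‖u t‖ ^ 2 := by gcongr
        _ = 2 * |deriv s t| ^ 2 * ‖u t‖ ^ 2 + 2 * |deriv s (T - t)| ^ 2 * ‖u t‖ ^ 2 := by ring
        _ ≤ _ := add_le_add (key _ _ (fun y hy => hy.1) ha)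
          (key _ _ (fun y hy => le_trans (by linarith) hy.1) hb')
    have hi : ∀ a b : ℝ, Integrable ((Set.Icc a b).indicator fun _ : ℝ => 2 * M) := fun a b =>
      (integrable_indicator_iff measurableSet_Icc).2 (integrableOn_const (by simp))
    calc _ ≤ ∫ t, ((Set.Icc (0 : ℝ) 1).indicator (fun _ => 2 * M) t
          + (Set.Icc (T - 1) T).indicator (fun _ => 2 * M) t) :=
          integral_mono (integrable_norm_sq (SchwartzMap.derivCLM ℂ X v - v.postcompCLM A))
            ((hi 0 1).add (hi _ _)) hb
      _ = 4 * M := by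
          rw [integral_add (hi _ _) (hi _ _), integral_indicator measurableSet_Icc,
            integral_indicator measurableSet_Icc]
          simp
          ring
  -- On the plateau of length `T - 2` the nonincreasing norm of the orbit is at least its value at
  -- `T`.
  have hlower : (T - 2) * ‖u T‖ ^ 2 ≤ ∫ t, ‖v t‖ ^ 2 := by
    have hi : Integrable ((Set.Icc 1 (T - 1)).indicator fun _ : ℝ => ‖u T‖ ^ 2) :=
      (integrable_indicator_iff measurableSet_Icc).2 (integrableOn_const (by simp))
    calc _ = ∫ t, (Set.Icc 1 (T - 1)).indicator (fun _ : ℝ => ‖u T‖ ^ 2) t := by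
          rw [integral_indicator measurableSet_Icc]
          simp
          left
          rw [max_eq_left (by linarith)]
          ring
      _ ≤ _ := by
          refine integral_mono hi (integrable_norm_sq v) fun t => ?_
          by_cases ht : t ∈ Set.Icc 1 (T - 1)
          · have h1 : φ t = 1 := by
              simp only [hφ, hs]
              rw [Real.smoothTransition.one_of_one_le ht.1,
                Real.smoothTransition.one_of_one_le (by linarith [ht.2]), one_mul]
            simp only [Set.indicator_of_mem ht, hvt, h1, one_smul]
            exact pow_le_pow_left₀ (norm_nonneg _) (hmono (by linarith [ht.2])) 2
          · simp only [Set.indicator_of_notMem ht]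
            positivity
  calc _ ≤ _ := hlower
    _ ≤ _ := integral_norm_sq_le_of_resolvent h v
    _ ≤ K ^ 2 * (4 * M) := by gcongr
    _ = _ := by rw [hM]; ring

end BoundedGenerator

/-! ### Yosida approximation of the inverse of a dissipative operator -/

section Yosida

open NormedSpace

variable {X : Type*} [NormedAddCommGroup X] [InnerProductSpace ℂ X]

theorem tendsto_zero_of_dense {ι : Type*} {l : Filter ι} {L : ι → X →L[ℂ] X} {C : ℝ} {D : Set X}
    (hD : Dense D) (hL : ∀ᶠ i in l, ∀ x, ‖L i x‖ ≤ C * ‖x‖)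
    (h : ∀ x ∈ D, Tendsto (fun i => L i x) l (𝓝 0)) (x : X) : Tendsto (fun i => L i x) l (𝓝 0) := by
  rw [Metric.tendsto_nhds]
  intro ε hε
  obtain ⟨d, hd, hxd⟩ := Metric.dense_iff.1 hD x (ε / (2 * (|C| + 1))) (by positivity)
  rw [Metric.mem_ball, dist_comm, dist_eq_norm] at hd
  filter_upwards [hL, Metric.tendsto_nhds.1 (h d hxd) (ε / 2) (by positivity)] with i h1 h2
  rw [dist_zero_right] at h2 ⊢
  have h3 : ‖L i (x - d)‖ ≤ ε / 2 := by
    calc _ ≤ C * ‖x - d‖ := h1 _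
      _ ≤ (|C| + 1) * ‖x - d‖ := by gcongr; linarith [le_abs_self C]
      _ ≤ (|C| + 1) * (ε / (2 * (|C| + 1))) := by gcongr
      _ = ε / 2 := by field_simp
  calc ‖L i x‖ = ‖L i (x - d) + L i d‖ := by rw [← map_add, sub_add_cancel]
    _ ≤ ‖L i (x - d)‖ + ‖L i d‖ := norm_add_le _ _
    _ < ε := by linarith

theorem IsDissipative.mul_norm_le_norm_sub {B : X →L[ℂ] X} (hB : IsDissipative B) (ε : ℝ)
    (y : X) : ε * ‖y‖ ≤ ‖B y - (ε : ℂ) • y‖ := by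
  have h1 : ε * ‖y‖ ^ 2 ≤ ‖B y - (ε : ℂ) • y‖ * ‖y‖ := by
    have h2 : (⟪B y - (ε : ℂ) • y, y⟫_ℂ).re = (⟪B y, y⟫_ℂ).re - ε * ‖y‖ ^ 2 := by
      rw [inner_sub_left, inner_smul_left, Complex.sub_re, Complex.conj_ofReal,
        Complex.re_ofReal_mul, inner_self_eq_norm_sq_to_K]
      simp [← Complex.ofReal_pow]
    have h3 := (Complex.abs_re_le_norm _).trans (norm_inner_le_norm (𝕜 := ℂ) (B y - (ε : ℂ) • y) y)
    have := neg_abs_le (⟪B y - (ε : ℂ) • y, y⟫_ℂ).re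
    linarith [hB y]
  rcases (norm_nonneg y).eq_or_lt with h0 | h0
  · rw [← h0]; simp
  · exact le_of_mul_le_mul_right (by linarith [h1]) h0


/-- The Yosida approximation `(B - ε)⁻¹` of `B⁻¹`. -/
def yosida (B : X →L[ℂ] X) (ε : ℝ) : X →L[ℂ] X := Ring.inverse (B - (ε : ℂ) • 1)

theorem commute_yosida (B : X →L[ℂ] X) (ε δ : ℝ) : Commute (yosida B ε) (yosida B δ) := by
  apply Commute.ringInverse_ringInverse
  simp only [commute_iff_eq, sub_mul, mul_sub, smul_mul_assoc, mul_smul_comm, one_mul, mul_one]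
  rw [smul_sub, smul_sub, smul_comm (δ : ℂ) (ε : ℂ)]
  abel

/-- The resolvent bound on the imaginary axis extends to the closed right half-plane. -/
theorem ResolventBound.norm_le_of_re_nonneg {B : X →L[ℂ] X} (hB : IsDissipative B)
    {K : ℝ} (hK : 0 ≤ K) (h : ResolventBound B K) {μ : ℂ}
    (hμ : 0 ≤ μ.re) (y : X) : ‖B y‖ ≤ 2 * K * ‖μ • B y - y‖ := by
  set g := μ • B y - y with hg
  -- Dissipativity controls the contribution of `Re μ`, so `μ` may be replaced by its imaginary part
  -- at the cost of a factor `2`.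
  have h1 : μ.re * ‖B y‖ ≤ ‖g‖ := by
    have h2 : (⟪B y, g⟫_ℂ).re = μ.re * ‖B y‖ ^ 2 - (⟪B y, y⟫_ℂ).re := by
      rw [hg, inner_sub_right, inner_smul_right, Complex.sub_re, inner_self_eq_norm_sq_to_K]
      simp only [Complex.coe_algebraMap, ← Complex.ofReal_pow, Complex.re_mul_ofReal]
    have h3 : (⟪B y, g⟫_ℂ).re ≤ ‖B y‖ * ‖g‖ := (Complex.re_le_norm _).trans (norm_inner_le_norm _ _)
    rcases (norm_nonneg (B y)).eq_or_lt with h0 | h0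
    · rw [← h0]; simp
    · refine le_of_mul_le_mul_left ?_ h0
      linarith [hB y]
  have h4 : ((μ.im : ℂ) * Complex.I) • B y - y = g - (μ.re : ℂ) • B y := by
    rw [hg]
    nth_rewrite 2 [← Complex.re_add_im μ]
    module
  calc ‖B y‖ ≤ K * ‖g - (μ.re : ℂ) • B y‖ := h4 ▸ h μ.im y
    _ ≤ K * (‖g‖ + ‖(μ.re : ℂ) • B y‖) := by gcongr; exact norm_sub_le _ _
    _ ≤ K * (‖g‖ + ‖g‖) := by
        rw [norm_smul, Complex.norm_real, Real.norm_of_nonneg hμ]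
        gcongr
    _ = _ := by ring

variable [CompleteSpace X]

/-- The orthogonal complement of the range is the kernel of `B†`, and for dissipative `B` this
kernel lies in that of `B`. -/
theorem IsDissipative.dense_range {B : X →L[ℂ] X} (hB : IsDissipative B)
    (hinj : ∀ y, B y = 0 → y = 0) : Dense (Set.range B) := by
  have : Dense ((B : X →ₗ[ℂ] X).range : Set X) := by
    rw [Submodule.dense_iff_topologicalClosure_eq_top, Submodule.topologicalClosure_eq_top_iff,
      Submodule.eq_bot_iff]
    intro y hy
    have h0 : (B†) y = 0 := by
      rw [← inner_self_eq_zero (𝕜 := ℂ), ContinuousLinearMap.adjoint_inner_right]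
      exact (Submodule.mem_orthogonal _ _).1 hy _ ⟨_, rfl⟩
    apply hinj
    rw [← inner_self_eq_zero (𝕜 := ℂ), ← ContinuousLinearMap.adjoint_inner_left]
    exact hB.adjoint.inner_apply_eq_zero h0 _
  exact this

theorem IsDissipative.isUnit_sub {B : X →L[ℂ] X} (hB : IsDissipative B) {ε : ℝ} (hε : 0 < ε) :
    IsUnit (B - (ε : ℂ) • 1) := by
  refine IsDissipative.isUnit_of_antilipschitz (fun x => ?_) hε fun x =>
    hB.mul_norm_le_norm_sub ε x
  change (⟪B x - (ε : ℂ) • x, x⟫_ℂ).re ≤ 0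
  rw [inner_sub_left, inner_smul_left, Complex.sub_re, Complex.conj_ofReal,
        Complex.re_ofReal_mul, inner_self_eq_norm_sq_to_K]
  simp only [Complex.coe_algebraMap, ← Complex.ofReal_pow, Complex.ofReal_re]
  have := hB x
  have : 0 ≤ ε * ‖x‖ ^ 2 := by positivity
  linarith

theorem yosida_apply_sub {B : X →L[ℂ] X} (hB : IsDissipative B) {ε : ℝ} (hε : 0 < ε)
    (y : X) : yosida B ε (B y - (ε : ℂ) • y) = y :=
  DFunLike.congr_fun (Ring.inverse_mul_cancel _ (hB.isUnit_sub hε)) y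

theorem apply_yosida {B : X →L[ℂ] X} (hB : IsDissipative B) {ε : ℝ} (hε : 0 < ε)
    (x : X) : B (yosida B ε x) = x + (ε : ℂ) • yosida B ε x := by
  have : B (yosida B ε x) - (ε : ℂ) • yosida B ε x = x :=
    DFunLike.congr_fun (Ring.mul_inverse_cancel _ (hB.isUnit_sub hε)) x
  rw [sub_eq_iff_eq_add] at this
  exact this

theorem yosida_apply {B : X →L[ℂ] X} (hB : IsDissipative B) {ε : ℝ} (hε : 0 < ε)
    (y : X) : yosida B ε (B y) = y + (ε : ℂ) • yosida B ε y := by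
  have := yosida_apply_sub hB hε y
  rwa [map_sub, map_smul, sub_eq_iff_eq_add] at this

theorem mul_norm_yosida_le {B : X →L[ℂ] X} (hB : IsDissipative B) {ε : ℝ} (hε : 0 < ε)
    (x : X) : ε * ‖yosida B ε x‖ ≤ ‖x‖ := by
  refine (hB.mul_norm_le_norm_sub ε _).trans_eq ?_
  rw [apply_yosida hB hε, add_sub_cancel_right]

theorem norm_yosida_apply_le {B : X →L[ℂ] X} (hB : IsDissipative B) {ε : ℝ} (hε : 0 < ε)
    (y : X) : ‖yosida B ε (B y)‖ ≤ 2 * ‖y‖ := by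
  rw [yosida_apply hB hε]
  refine (norm_add_le _ _).trans ?_
  rw [norm_smul, Complex.norm_real, Real.norm_of_nonneg hε.le]
  linarith [mul_norm_yosida_le hB hε y]

theorem isDissipative_yosida {B : X →L[ℂ] X} (hB : IsDissipative B) {ε : ℝ} (hε : 0 < ε) :
    IsDissipative (yosida B ε) := fun x => by
  have h1 : (⟪yosida B ε x, x⟫_ℂ) =
      ⟪yosida B ε x, B (yosida B ε x)⟫_ℂ - (ε : ℂ) * ((‖yosida B ε x‖ ^ 2 : ℝ) : ℂ) := by
    rw [apply_yosida hB hε, inner_add_right, inner_smul_right, inner_self_eq_norm_sq_to_K]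
    simp
  rw [h1, Complex.sub_re, re_inner_comm, Complex.re_ofReal_mul, Complex.ofReal_re]
  have := hB (yosida B ε x)
  have : 0 ≤ ε * ‖yosida B ε x‖ ^ 2 := by positivity
  linarith

/-- With `y = (B - ε)⁻¹ x` one has `iτ x - y = s (μ B y - y)`, where `s = 1 + iτε` and `μ = iτ / s`.
Here `Re μ ≥ 0`, `|s| ≥ 1` and `ε |μ| ≤ 1`, so the half-plane bound for `B` controls both `B y` and
`ε y`. -/
theorem norm_le_of_yosida {B : X →L[ℂ] X} (hB : IsDissipative B) {ε : ℝ} (hε : 0 < ε)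
    {K : ℝ} (hK : 0 ≤ K) (h : ResolventBound B K) (τ : ℝ) (x : X) :
    ‖x‖ ≤ (4 * K + ε) * ‖((τ : ℂ) * Complex.I) • x - yosida B ε x‖ := by
  set y := yosida B ε x with hy
  set g := ((τ : ℂ) * Complex.I) • x - y with hg
  have hx : x = B y - (ε : ℂ) • y := by rw [hy, apply_yosida hB hε, add_sub_cancel_right]
  set s : ℂ := 1 + (τ : ℂ) * Complex.I * ε with hs
  have hsre : s.re = 1 := by simp [hs, Complex.mul_re]
  have hsim : s.im = τ * ε := by simp [hs, Complex.mul_im]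
  have hs1 : 1 ≤ ‖s‖ := by
    have := Complex.re_le_norm s
    rwa [hsre] at this
  have hs0 : s ≠ 0 := norm_pos_iff.1 (by linarith)
  set μ : ℂ := (τ : ℂ) * Complex.I / s with hμdef
  have hμs : s * μ = (τ : ℂ) * Complex.I := mul_div_cancel₀ _ hs0
  have hμ : 0 ≤ μ.re := by
    rw [hμdef, Complex.div_re]
    have : 0 ≤ τ * (τ * ε) / Complex.normSq s :=
      div_nonneg (by nlinarith [mul_self_nonneg τ]) (Complex.normSq_nonneg _)
    simpa [hsim] using this
  have hεμ : ε * ‖μ‖ ≤ 1 := by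
    rw [hμdef, norm_div, mul_div_assoc', div_le_one (by linarith)]
    have := Complex.abs_im_le_norm s
    rw [hsim, abs_mul, abs_of_pos hε] at this
    simpa [mul_comm] using this
  have hgs : g = s • (μ • B y - y) := by
    rw [smul_sub, smul_smul, hμs, hg, hx, hs]
    module
  have hle : ‖μ • B y - y‖ ≤ ‖g‖ := by
    rw [hgs, norm_smul]
    exact le_mul_of_one_le_left (norm_nonneg _) hs1
  have hb : ‖B y‖ ≤ 2 * K * ‖g‖ :=
    (h.norm_le_of_re_nonneg hB hK hμ y).trans (by gcongr)
  have hεy : ε * ‖y‖ ≤ 2 * K * ‖g‖ + ε * ‖g‖ := by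
    calc ε * ‖y‖ = ε * ‖μ • B y - (μ • B y - y)‖ := by rw [sub_sub_cancel]
      _ ≤ ε * (‖μ‖ * ‖B y‖ + ‖μ • B y - y‖) := by
          gcongr
          exact (norm_sub_le _ _).trans_eq (by rw [norm_smul])
      _ = (ε * ‖μ‖) * ‖B y‖ + ε * ‖μ • B y - y‖ := by ring
      _ ≤ 1 * (2 * K * ‖g‖) + ε * ‖g‖ := by gcongr
      _ = _ := by ring
  calc ‖x‖ = ‖B y - (ε : ℂ) • y‖ := by rw [← hx]
    _ ≤ ‖B y‖ + ‖(ε : ℂ) • y‖ := norm_sub_le _ _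
    _ = ‖B y‖ + ε * ‖y‖ := by rw [norm_smul, Complex.norm_real, Real.norm_of_nonneg hε.le]
    _ ≤ 2 * K * ‖g‖ + (2 * K * ‖g‖ + ε * ‖g‖) := add_le_add hb hεy
    _ = _ := by ring

/-- Since `(B - ε)⁻¹ B y = y + ε (B - ε)⁻¹ y`, it suffices that `ε (B - ε)⁻¹` tends strongly to
zero. These operators are contractions, and on the dense range of `B` they are of order `ε`. -/
theorem tendsto_yosida_apply {B : X →L[ℂ] X} (hB : IsDissipative B) (hinj : ∀ y, B y = 0 → y = 0)
    (y : X) : Tendsto (fun ε => yosida B ε (B y)) (𝓝[>] 0) (𝓝 y) := by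
  have h0 : Tendsto (fun ε : ℝ => ((ε : ℂ) • yosida B ε) y) (𝓝[>] 0) (𝓝 0) := by
    refine tendsto_zero_of_dense (C := 1) (hB.dense_range hinj) ?_ ?_ y
    · filter_upwards [self_mem_nhdsWithin] with ε hε x
      rw [smul_apply, norm_smul, Complex.norm_real, Real.norm_of_nonneg (le_of_lt hε), one_mul]
      exact mul_norm_yosida_le hB hε x
    · rintro _ ⟨z, rfl⟩
      rw [tendsto_zero_iff_norm_tendsto_zero]
      have hlim : Tendsto (fun ε : ℝ => ε * (2 * ‖z‖)) (𝓝[>] 0) (𝓝 0) := by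
        have : Tendsto (fun ε : ℝ => ε * (2 * ‖z‖)) (𝓝 0) (𝓝 (0 * (2 * ‖z‖))) :=
          (continuous_id.mul continuous_const).tendsto 0
        rw [zero_mul] at this
        exact this.mono_left nhdsWithin_le_nhds
      refine squeeze_zero' (Eventually.of_forall fun _ => norm_nonneg _) ?_ hlim
      filter_upwards [self_mem_nhdsWithin] with ε hε
      rw [smul_apply, norm_smul, Complex.norm_real, Real.norm_of_nonneg (le_of_lt hε)]
      exact mul_le_mul_of_nonneg_left (norm_yosida_apply_le hB hε z) (le_of_lt hε)
  have h1 := h0.const_add y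
  rw [add_zero] at h1
  refine h1.congr' ?_
  filter_upwards [self_mem_nhdsWithin] with ε hε
  rw [yosida_apply hB hε, smul_apply]

/-! ### The limit semigroup -/

/-- The path `s ↦ e^{(t-s)A} e^{sA'} x` joins the two vectors, and its derivative `e^{(t-s)A}
e^{sA'} (A' x - A x)` is a product of contractions applied to the difference. Commutativity gives
the path the form `e^{tA} e^{s(A'-A)} x`. -/
theorem norm_exp_smul_sub_le {A A' : X →L[ℂ] X} (hA : IsDissipative A) (hA' : IsDissipative A')
    (hc : Commute A A') {t : ℝ} (ht : 0 ≤ t) (x : X) :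
    ‖exp (t • A') x - exp (t • A) x‖ ≤ t * ‖A' x - A x‖ := by
  have hG : ∀ s : ℝ, exp (t • A) * exp (s • (A' - A)) = exp ((t - s) • A) * exp (s • A') := by
    intro s
    let : NormedAlgebra ℚ (X →L[ℂ] X) := NormedAlgebra.restrictScalars ℚ ℂ _
    have c1 : Commute A (A' - A) := hc.sub_right (Commute.refl A)
    rw [← exp_add_of_commute ((c1.smul_left t).smul_right s),
      ← exp_add_of_commute ((hc.smul_left (t - s)).smul_right s)]
    congr 1
    module
  have hd : ∀ s ∈ Set.Icc (0 : ℝ) t, HasDerivWithinAt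
      (fun s : ℝ => exp (t • A) (exp (s • (A' - A)) x))
      (exp ((t - s) • A) (exp (s • A') (A' x - A x))) (Set.Icc 0 t) s := by
    intro s _
    have h1 := hasDerivAt_exp_smul_const (𝕂 := ℝ) (A' - A) s
    have h2 := (((ContinuousLinearMap.apply ℂ X x).restrictScalars ℝ).hasFDerivAt).comp_hasDerivAt s
      h1
    have h3 := (((exp (t • A)).restrictScalars ℝ).hasFDerivAt).comp_hasDerivAt s h2
    refine HasDerivAt.hasDerivWithinAt (h3.congr_deriv ?_)
    exact DFunLike.congr_fun (hG s) (A' x - A x)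
  have := norm_image_sub_le_of_norm_deriv_le_segment' hd (C := ‖A' x - A x‖) (fun s hs =>
    (norm_exp_smul_apply_le hA (by linarith [hs.2]) _).trans (norm_exp_smul_apply_le hA' hs.1 _))
    t ⟨ht, le_rfl⟩
  have e : ∀ s : ℝ, exp (t • A) (exp (s • (A' - A)) x) = exp ((t - s) • A) (exp (s • A') x) :=
    fun s => DFunLike.congr_fun (hG s) x
  simp only [e] at this
  simpa [mul_comm] using this

theorem norm_exp_smul_sub_self_le {A : X →L[ℂ] X} (hA : IsDissipative A) {t : ℝ} (ht : 0 ≤ t)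
    (x : X) : ‖exp (t • A) x - x‖ ≤ t * ‖A x‖ := by
  have := norm_exp_smul_sub_le (A := 0) (A' := A) (fun x => by simp) hA (Commute.zero_left A) ht x
  simpa using this

theorem norm_exp_smul_sub_sub_le {A : X →L[ℂ] X} (hA : IsDissipative A) {t : ℝ} (ht : 0 ≤ t)
    (x : X) : ‖exp (t • A) x - x - t • A x‖ ≤ t ^ 2 * ‖A (A x)‖ := by
  have hd : ∀ s ∈ Set.Icc (0 : ℝ) t, HasDerivWithinAt (fun s : ℝ => exp (s • A) x - s • A x)
      (exp (s • A) (A x) - A x) (Set.Icc 0 t) s := by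
    intro s _
    have h1 := (((ContinuousLinearMap.apply ℂ X x).restrictScalars ℝ).hasFDerivAt).comp_hasDerivAt s
      (hasDerivAt_exp_smul_const (𝕂 := ℝ) A s)
    have h2 := (hasDerivAt_id s).smul_const (A x)
    rw [one_smul] at h2
    exact (h1.sub h2).hasDerivWithinAt
  have := norm_image_sub_le_of_norm_deriv_le_segment' hd (C := t * ‖A (A x)‖) (fun s hs =>
    (norm_exp_smul_sub_self_le hA hs.1 _).trans (by gcongr; exact hs.2.le)) t ⟨ht, le_rfl⟩
  simp only [zero_smul, exp_zero, sub_zero, one_apply_eq_self] at this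
  calc _ = ‖exp (t • A) x - t • A x - x‖ := by congr 1; abel
    _ ≤ _ := this
    _ = _ := by ring

end Yosida

/-! ### Exponential stability from a resolvent bound -/

section ExpStability

open NormedSpace

variable {X : Type*} [NormedAddCommGroup X] [InnerProductSpace ℂ X]

/-- A contraction semigroup whose norm drops to `1 / 2` at some time decays exponentially. -/
theorem IsC0Semigroup.exp_bound {T : ℝ → X →L[ℂ] X} (hT : IsC0Semigroup T)
    (hcontr : ∀ t, 0 ≤ t → ∀ x, ‖T t x‖ ≤ ‖x‖) {τ : ℝ} (hτ : 0 < τ)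
    (hhalf : ∀ x, ‖T τ x‖ ≤ 1 / 2 * ‖x‖) :
    ∃ c β : ℝ, 0 < c ∧ 0 < β ∧ ∀ t : ℝ, 0 ≤ t → ‖T t‖ ≤ c * Real.exp (-(β * t)) := by
  have hpow : ∀ (k : ℕ) (r : ℝ), 0 ≤ r → ∀ x, ‖T (k * τ + r) x‖ ≤ (1 / 2) ^ k * ‖x‖ := by
    intro k r hr
    induction k with
    | zero => intro x; simpa using hcontr r hr x
    | succ k ih =>
      intro x
      have e : ((k + 1 : ℕ) : ℝ) * τ + r = τ + (k * τ + r) := by push_cast; ring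
      rw [e, hT.map_add _ _ hτ.le (by positivity), ContinuousLinearMap.comp_apply]
      calc _ ≤ 1 / 2 * ‖T (k * τ + r) x‖ := hhalf _
        _ ≤ 1 / 2 * ((1 / 2) ^ k * ‖x‖) := by gcongr; exact ih x
        _ = _ := by ring
  have hl : 0 < Real.log 2 := Real.log_pos one_lt_two
  -- The factor `2` pays for rounding `t / τ` down: `(1/2)^⌊t/τ⌋ ≤ 2 · 2^{-t/τ}`.
  refine ⟨2, Real.log 2 / τ, two_pos, by positivity, fun t ht => ?_⟩
  refine ContinuousLinearMap.opNorm_le_bound _ (by positivity) fun x => ?_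
  set k := ⌊t / τ⌋₊ with hk
  have hk1 : (k : ℝ) * τ ≤ t := (le_div_iff₀ hτ).1 (Nat.floor_le (by positivity))
  have hk2 : t / τ < k + 1 := Nat.lt_floor_add_one _
  have h1 := hpow k (t - k * τ) (by linarith) x
  rw [add_sub_cancel] at h1
  refine h1.trans ?_
  gcongr
  have h2 : ((1 : ℝ) / 2) ^ k = Real.exp (-(Real.log 2 * k)) := by
    rw [Real.exp_neg, mul_comm, Real.exp_nat_mul, Real.exp_log two_pos, one_div, inv_pow]
  have h3 : (2 : ℝ) * Real.exp (-(Real.log 2 / τ * t))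
      = Real.exp (Real.log 2 + -(Real.log 2 / τ * t)) := by
    rw [Real.exp_add, Real.exp_log two_pos]
  rw [h2, h3, Real.exp_le_exp]
  have h4 : Real.log 2 / τ * t = Real.log 2 * (t / τ) := by ring
  rw [h4]
  nlinarith

variable [CompleteSpace X]

/-- The exponentials of the Yosida approximations converge strongly. -/
theorem exists_tendsto_exp_yosida {B : X →L[ℂ] X} (hB : IsDissipative B)
    (hinj : ∀ y, B y = 0 → y = 0) {t : ℝ} (ht : 0 ≤ t) :
    ∃ L : X →L[ℂ] X, ∀ x,
      Tendsto (fun n : ℕ => exp (t • yosida B (1 / ((n : ℝ) + 1))) x) atTop (𝓝 (L x)) := by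
  set A : ℕ → X →L[ℂ] X := fun n => yosida B (1 / ((n : ℝ) + 1)) with hA
  have hpos : ∀ n : ℕ, (0 : ℝ) < 1 / ((n : ℝ) + 1) := fun n => Nat.one_div_pos_of_nat
  have hAd : ∀ n, IsDissipative (A n) := fun n => isDissipative_yosida hB (hpos n)
  have hlim : Tendsto (fun n : ℕ => 1 / ((n : ℝ) + 1)) atTop (𝓝[>] 0) :=
    tendsto_nhdsWithin_iff.2 ⟨tendsto_one_div_add_atTop_nhds_zero_nat, Eventually.of_forall hpos⟩
  have hcauchy : ∀ x, CauchySeq fun n => exp (t • A n) x := by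
    intro x
    rw [cauchySeq_iff_tendsto_dist_atTop_0]
    have : Tendsto (fun p : ℕ × ℕ => (exp (t • A p.1) - exp (t • A p.2)) x) atTop (𝓝 0) := by
      refine tendsto_zero_of_dense (C := 2) (hB.dense_range hinj)
        (Eventually.of_forall fun p x => ?_) ?_ x
      · have h1 := norm_exp_smul_apply_le (hAd p.1) ht x
        have h2 := norm_exp_smul_apply_le (hAd p.2) ht x
        rw [sub_apply]
        linarith [norm_sub_le (exp (t • A p.1) x) (exp (t • A p.2) x)]
      · rintro _ ⟨y, rfl⟩
        have hc : CauchySeq fun n => A n (B y) :=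
          ((tendsto_yosida_apply hB hinj y).comp hlim).cauchySeq
        rw [cauchySeq_iff_tendsto_dist_atTop_0] at hc
        have hc' := hc.const_mul t
        rw [mul_zero] at hc'
        rw [tendsto_zero_iff_norm_tendsto_zero]
        refine squeeze_zero (fun _ => norm_nonneg _) (fun p => ?_) hc'
        rw [dist_eq_norm]
        exact norm_exp_smul_sub_le (hAd _) (hAd _) (commute_yosida B _ _) ht _
    rw [tendsto_zero_iff_norm_tendsto_zero] at this
    simpa only [dist_eq_norm, sub_apply] using this
  choose f hf using fun x => cauchySeq_tendsto_of_complete (hcauchy x)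
  exact ⟨continuousLinearMapOfTendsto (fun n => exp (t • A n)) (tendsto_pi_nhds.2 hf), hf⟩

/-- The inverse of an injective bounded dissipative operator generates a contraction semigroup,
which is exponentially stable if the resolvent is bounded on the imaginary axis. -/
theorem exists_expStable_semigroup {B : X →L[ℂ] X} (hB : IsDissipative B)
    (hinj : ∀ y, B y = 0 → y = 0) {K : ℝ} (hK : 0 ≤ K) (hR : ResolventBound B K) :
    ∃ T : ℝ → X →L[ℂ] X, IsC0Semigroup T ∧
      (∀ x y : X, B y = x ↔
        Tendsto (fun h : ℝ => ((h⁻¹ : ℝ) : ℂ) • (T h x - x)) (𝓝[>] 0) (𝓝 y)) ∧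
      ∃ c β : ℝ, 0 < c ∧ 0 < β ∧ ∀ t : ℝ, 0 ≤ t → ‖T t‖ ≤ c * Real.exp (-(β * t)) := by
  set A : ℕ → X →L[ℂ] X := fun n => yosida B (1 / ((n : ℝ) + 1)) with hA
  have hpos : ∀ n : ℕ, (0 : ℝ) < 1 / ((n : ℝ) + 1) := fun n => Nat.one_div_pos_of_nat
  have hAd : ∀ n, IsDissipative (A n) := fun n => isDissipative_yosida hB (hpos n)
  have hlim : Tendsto (fun n : ℕ => 1 / ((n : ℝ) + 1)) atTop (𝓝[>] 0) :=
    tendsto_nhdsWithin_iff.2 ⟨tendsto_one_div_add_atTop_nhds_zero_nat, Eventually.of_forall hpos⟩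
  have hAlim : ∀ y, Tendsto (fun n => A n (B y)) atTop (𝓝 y) := fun y =>
    (tendsto_yosida_apply hB hinj y).comp hlim
  -- Negative times carry no requirement; the witness `0` there only makes the choice of `T` total.
  have hex : ∀ t : ℝ, ∃ L : X →L[ℂ] X, 0 ≤ t → ∀ x,
      Tendsto (fun n : ℕ => exp (t • A n) x) atTop (𝓝 (L x)) := fun t => by
    by_cases ht : 0 ≤ t
    · obtain ⟨L, hL⟩ := exists_tendsto_exp_yosida hB hinj ht
      exact ⟨L, fun _ => hL⟩
    · exact ⟨0, fun h => absurd h ht⟩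
  choose T hT using hex
  have hcontr : ∀ t, 0 ≤ t → ∀ x, ‖T t x‖ ≤ ‖x‖ := fun t ht x =>
    le_of_tendsto (hT t ht x).norm (Eventually.of_forall fun n => norm_exp_smul_apply_le (hAd n) ht x)
  have hdense := hB.dense_range hinj
  have hone : ∀ t, 0 ≤ t → ∀ y, ‖T t (B y) - B y‖ ≤ t * ‖y‖ := fun t ht y =>
    le_of_tendsto_of_tendsto ((hT t ht (B y)).sub_const (B y)).norm ((hAlim y).norm.const_mul t)
      (Eventually.of_forall fun n => norm_exp_smul_sub_self_le (hAd n) ht (B y))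
  -- A second-order estimate on the range of `B²`. It gives the derivative at zero on a dense set,
  -- and the bound `hone` extends it to all of the range of `B`.
  have htwo : ∀ t, 0 ≤ t → ∀ z, ‖T t (B (B z)) - B (B z) - t • B z‖ ≤ t ^ 2 * (4 * ‖z‖) := by
    intro t ht z
    refine le_of_tendsto (((hT t ht (B (B z))).sub_const _).sub
      ((hAlim (B z)).const_smul t)).norm (Eventually.of_forall fun n => ?_)
    refine (norm_exp_smul_sub_sub_le (hAd n) ht _).trans ?_
    gcongr
    have : A n (B (B z)) = B (A n (B z)) := by
      rw [hA, yosida_apply hB (hpos n), apply_yosida hB (hpos n)]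
    rw [this]
    calc _ ≤ 2 * ‖A n (B z)‖ := norm_yosida_apply_le hB (hpos n) _
      _ ≤ 2 * (2 * ‖z‖) := by gcongr; exact norm_yosida_apply_le hB (hpos n) _
      _ = _ := by ring
  have hpow0 : ∀ a : ℝ, Tendsto (fun h : ℝ => h * a) (𝓝[>] 0) (𝓝 0) := fun a => by
    have : Tendsto (fun h : ℝ => h * a) (𝓝 0) (𝓝 (0 * a)) :=
      (continuous_id.mul continuous_const).tendsto 0
    rw [zero_mul] at this
    exact this.mono_left nhdsWithin_le_nhds
  have hC0 : IsC0Semigroup T := by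
    refine ⟨?_, fun s t hs ht => ?_, fun x => ?_⟩
    · ext x
      refine tendsto_nhds_unique (hT 0 le_rfl x) ?_
      simp
    · ext x
      refine tendsto_nhds_unique (hT (s + t) (add_nonneg hs ht) x) ?_
      rw [ContinuousLinearMap.comp_apply]
      have h1 : ∀ n, exp ((s + t) • A n) x = exp (s • A n) (exp (t • A n) x) := fun n => by
        let : NormedAlgebra ℚ (X →L[ℂ] X) := NormedAlgebra.restrictScalars ℚ ℂ _
        rw [add_smul, exp_add_of_commute (((Commute.refl (A n)).smul_left s).smul_right t)]
        rfl
      have h2 : Tendsto (fun n => exp (s • A n) (exp (t • A n) x - T t x)) atTop (𝓝 0) := by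
        rw [tendsto_zero_iff_norm_tendsto_zero]
        refine squeeze_zero (fun _ => norm_nonneg _)
          (fun n => norm_exp_smul_apply_le (hAd n) hs _) ?_
        have := ((hT t ht x).sub_const (T t x)).norm
        simpa using this
      have h3 := h2.add (hT s hs (T t x))
      rw [zero_add] at h3
      refine h3.congr fun n => ?_
      rw [h1, ← map_add, sub_add_cancel]
    · have : Tendsto (fun h => (T h - 1) x) (𝓝[>] 0) (𝓝 0) := by
        refine tendsto_zero_of_dense (C := 2) hdense ?_ ?_ x
        · filter_upwards [self_mem_nhdsWithin] with h hh x
          rw [sub_apply, one_apply_eq_self]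
          linarith [norm_sub_le (T h x) x, hcontr h (le_of_lt hh) x]
        · rintro _ ⟨y, rfl⟩
          rw [tendsto_zero_iff_norm_tendsto_zero]
          refine squeeze_zero' (Eventually.of_forall fun _ => norm_nonneg _) ?_ (hpow0 ‖y‖)
          filter_upwards [self_mem_nhdsWithin] with h hh
          exact hone h (le_of_lt hh) y
      have h2 := this.add_const x
      rw [zero_add] at h2
      refine h2.congr fun h => ?_
      rw [sub_apply, one_apply_eq_self, sub_add_cancel]
  have hgen1 : ∀ y, Tendsto (fun h : ℝ => ((h⁻¹ : ℝ) : ℂ) • (T h (B y) - B y)) (𝓝[>] 0) (𝓝 y) := by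
    intro y
    have : Tendsto (fun h : ℝ => (((h⁻¹ : ℝ) : ℂ) • ((T h - 1) * B) - 1) y) (𝓝[>] 0) (𝓝 0) := by
      refine tendsto_zero_of_dense (C := 2) hdense ?_ ?_ y
      · filter_upwards [self_mem_nhdsWithin] with h hh x
        have hh' : 0 < h := hh
        have h1 : ‖((h⁻¹ : ℝ) : ℂ) • (T h (B x) - B x)‖ ≤ ‖x‖ := by
          rw [norm_smul, Complex.norm_real, Real.norm_of_nonneg (by positivity),
            inv_mul_le_iff₀ hh']
          exact hone h hh'.le x
        change ‖((h⁻¹ : ℝ) : ℂ) • (T h (B x) - B x) - x‖ ≤ _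
        linarith [norm_sub_le (((h⁻¹ : ℝ) : ℂ) • (T h (B x) - B x)) x]
      · rintro _ ⟨z, rfl⟩
        rw [tendsto_zero_iff_norm_tendsto_zero]
        refine squeeze_zero' (Eventually.of_forall fun _ => norm_nonneg _) ?_ (hpow0 (4 * ‖z‖))
        filter_upwards [self_mem_nhdsWithin] with h hh
        have hh' : 0 < h := hh
        have e : (((h⁻¹ : ℝ) : ℂ) • ((T h - 1) * B) - 1) (B z)
            = ((h⁻¹ : ℝ) : ℂ) • (T h (B (B z)) - B (B z) - h • B z) := by
          have e0 : ((h⁻¹ : ℝ) : ℂ) • h • B z = B z := by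
            rw [Complex.coe_smul, smul_smul, inv_mul_cancel₀ hh'.ne', one_smul]
          rw [smul_sub _ _ (h • B z), e0]
          rfl
        rw [e, norm_smul, Complex.norm_real, Real.norm_of_nonneg (by positivity),
            inv_mul_le_iff₀ hh']
        refine (htwo h hh'.le z).trans_eq (by ring)
    have h2 := this.add_const y
    rw [zero_add] at h2
    refine h2.congr fun h => ?_
    rw [sub_apply, one_apply_eq_self, sub_add_cancel]
    rfl
  refine ⟨T, hC0, fun x y => ⟨?_, fun hxy => ?_⟩, ?_⟩
  · rintro rfl
    exact hgen1 y
  -- To see that the generator is no larger than `B⁻¹`, subtract the known pair `(B z, z)` from `(x,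
  -- y)`, with `z` chosen so that the remainder is `(w, w)`. A contraction semigroup has no growing
  -- mode with rate `1`, so `w = 0`.
  · obtain ⟨z, hz⟩ := (ContinuousLinearMap.isUnit_iff_bijective.1 (hB.isUnit_sub one_pos)).2 (x - y)
    have hz' : B z - z = x - y := by simpa using hz
    set w := x - B z with hw
    have hwy : w = y - z := by
      rw [sub_eq_sub_iff_add_eq_add] at hz'
      rw [hw, sub_eq_sub_iff_add_eq_add, ← hz', add_comm]
    have hlimw : Tendsto (fun h : ℝ => ((h⁻¹ : ℝ) : ℂ) • (T h w - w)) (𝓝[>] 0) (𝓝 w) := by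
      have := hxy.sub (hgen1 z)
      rw [← hwy] at this
      refine this.congr fun h => ?_
      rw [← smul_sub, hw, map_sub]
      congr 1
      abel
    have hre : (⟪w, w⟫_ℂ).re ≤ 0 := by
      refine le_of_tendsto ((Complex.continuous_re.tendsto _).comp
        ((tendsto_const_nhds (x := w)).inner hlimw)) ?_
      filter_upwards [self_mem_nhdsWithin] with h hh
      have hh' : 0 < h := hh
      have h1 : (⟪w, T h w⟫_ℂ).re ≤ ‖w‖ * ‖w‖ :=
        (Complex.re_le_norm _).trans ((norm_inner_le_norm _ _).trans
          (by gcongr; exact hcontr h hh'.le w))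
      have h2 : (⟪w, w⟫_ℂ).re = ‖w‖ * ‖w‖ := by
        rw [inner_self_eq_norm_sq_to_K]
        simp [sq]
      change (⟪w, ((h⁻¹ : ℝ) : ℂ) • (T h w - w)⟫_ℂ).re ≤ 0
      rw [inner_smul_right, Complex.re_ofReal_mul, inner_sub_right, Complex.sub_re, h2]
      exact mul_nonpos_of_nonneg_of_nonpos (by positivity) (by linarith)
    have hw0 : w = 0 := by
      have : RCLike.re (⟪w, w⟫_ℂ) = ‖w‖ ^ 2 := inner_self_eq_norm_sq w
      rw [RCLike.re_eq_complex_re] at this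
      have h3 : ‖w‖ = 0 := by nlinarith [norm_nonneg w]
      exact norm_eq_zero.1 h3
    rw [hw0, eq_comm, sub_eq_zero] at hwy
    rw [hw0, eq_comm, sub_eq_zero] at hw
    rw [hwy, ← hw]
  · obtain ⟨c, hc0, hc⟩ := exists_decay_const X
    set q := c * (4 * K + 1) ^ 2 with hq
    have hq0 : 0 ≤ q := by positivity
    -- At this time the decay estimate reads `(4q + 1) ‖·‖² ≤ q ‖x‖²`, so the norm has dropped by at
    -- least half. Since `ε ≤ 1`, the constant `4K + 1` serves all approximations.
    refine hC0.exp_bound hcontr (τ := 4 * q + 3) (by positivity) fun x => ?_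
    refine le_of_tendsto (hT _ (by positivity) x).norm (Eventually.of_forall fun n => ?_)
    have hn : (1 : ℝ) / ((n : ℝ) + 1) ≤ 1 := by
      rw [div_le_one (by positivity)]
      linarith [(Nat.cast_nonneg n : (0 : ℝ) ≤ n)]
    have := hc (A n) (4 * K + 1) (4 * q + 3) (hAd n) (by linarith) (fun ω x =>
      (norm_le_of_yosida hB (hpos n) hK hR ω x).trans (by gcongr)) x
    rw [← hq] at this
    have h4 : ‖exp ((4 * q + 3) • A n) x‖ ^ 2 ≤ (1 / 2 * ‖x‖) ^ 2 := by
      nlinarith [sq_nonneg ‖x‖, sq_nonneg ‖exp ((4 * q + 3) • A n) x‖]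
    exact (pow_le_pow_iff_left₀ (norm_nonneg _) (by positivity) two_ne_zero).1 h4

end ExpStability

/-! ### Consequences of exponential stability for the generator -/

section Necessity

open MeasureTheory Set

variable {X : Type*} [NormedAddCommGroup X] [NormedSpace ℂ X]

/-- Freezing the orbit for negative times gives a function continuous on the whole line. The
semigroup law and the uniform bound reduce continuity at every point to right continuity at zero. -/
theorem IsC0Semigroup.continuous_max {T : ℝ → X →L[ℂ] X} (hT : IsC0Semigroup T) {c : ℝ}
    (hc : ∀ t, 0 ≤ t → ‖T t‖ ≤ c) (x : X) : Continuous fun t : ℝ => T (max t 0) x := by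
  have hle : ∀ s t : ℝ, 0 ≤ s → s ≤ t → ‖T t x - T s x‖ ≤ c * ‖T (t - s) x - x‖ := by
    intro s t hs hst
    have e : T t x = T s (T (t - s) x) := by
      rw [← ContinuousLinearMap.comp_apply, ← hT.map_add _ _ hs (sub_nonneg.2 hst)]
      congr 2
      ring
    rw [e, ← map_sub]
    exact (T s).le_of_opNorm_le (hc s hs) _
  have hle' : ∀ s t : ℝ, ‖T (max t 0) x - T (max s 0) x‖ ≤ c * ‖T |max t 0 - max s 0| x - x‖ := by
    intro s t
    rcases le_total (max s 0) (max t 0) with h | h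
    · rw [abs_of_nonneg (sub_nonneg.2 h)]
      exact hle _ _ (le_max_right _ _) h
    · rw [abs_of_nonpos (sub_nonpos.2 h), neg_sub, norm_sub_rev]
      exact hle _ _ (le_max_right _ _) h
  have h0 : Tendsto (fun r => T r x) (𝓝[≥] 0) (𝓝 x) := by
    rw [← Ioi_insert, nhdsWithin_insert, tendsto_sup]
    refine ⟨?_, hT.tendsto_zero x⟩
    rw [tendsto_pure_left]
    intro s hs
    simpa [hT.map_zero] using mem_of_mem_nhds hs
  rw [continuous_iff_continuousAt]
  intro s
  rw [ContinuousAt, tendsto_iff_norm_sub_tendsto_zero]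
  have h1 : Tendsto (fun t : ℝ => |max t 0 - max s 0|) (𝓝 s) (𝓝[≥] 0) := by
    refine tendsto_nhdsWithin_iff.2 ⟨?_, Eventually.of_forall fun t => mem_Ici.2 (abs_nonneg _)⟩
    have : Continuous fun t : ℝ => |max t 0 - max s 0| := by fun_prop
    simpa using this.tendsto s
  have h2 := ((tendsto_iff_norm_sub_tendsto_zero.1 (h0.comp h1))).const_mul c
  rw [mul_zero] at h2
  exact squeeze_zero (fun _ => norm_nonneg _) (hle' s) h2

theorem IsC0Semigroup.hasDerivWithinAt {T : ℝ → X →L[ℂ] X} (hT : IsC0Semigroup T) {x y : X}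
    (h : Tendsto (fun h : ℝ => ((h⁻¹ : ℝ) : ℂ) • (T h x - x)) (𝓝[>] 0) (𝓝 y)) {t : ℝ}
    (ht : 0 ≤ t) : HasDerivWithinAt (fun t => T t x) (T t y) (Ici t) t := by
  rw [← hasDerivWithinAt_Ioi_iff_Ici, hasDerivWithinAt_iff_tendsto_slope' self_notMem_Ioi]
  have h1 : Tendsto (fun s : ℝ => s - t) (𝓝[>] t) (𝓝[>] 0) := by
    refine tendsto_nhdsWithin_iff.2 ⟨?_, ?_⟩
    · have : Continuous fun s : ℝ => s - t := by fun_prop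
      simpa using (this.tendsto t).mono_left nhdsWithin_le_nhds
    · filter_upwards [self_mem_nhdsWithin] with s hs
      exact mem_Ioi.2 (sub_pos.2 (mem_Ioi.1 hs))
  refine ((((T t).continuous.tendsto y).comp (h.comp h1))).congr' ?_
  filter_upwards [self_mem_nhdsWithin] with s hs
  have hs' : t < s := hs
  have e : T s x = T t (T (s - t) x) := by
    rw [← ContinuousLinearMap.comp_apply, ← hT.map_add _ _ ht (sub_nonneg.2 hs'.le)]
    congr 2
    ring
  rw [slope_def_module, e, ← map_sub, ← Complex.coe_smul, ← map_smul]
  rfl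

/-- The curve `e^{-iωt} T(t) x` tends to zero and has right derivative `e^{-iωt} T(t) (y - iω x)`,
of norm at most `c e^{-βt} ‖iω x - y‖`. Integrating over the half-line gives `K = c / β`. -/
theorem GeneratesExpStable.exists_resolvent_bound {A : X →ₗ.[ℂ] X} (hA : GeneratesExpStable A) :
    ∃ K : ℝ, 0 ≤ K ∧ ∀ (ω : ℝ) (x y : X), (x, y) ∈ A.graph →
      ‖x‖ ≤ K * ‖((ω : ℂ) * Complex.I) • x - y‖ := by
  obtain ⟨T, hT, hgen, c, β, hc, hβ, hb⟩ := hA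
  refine ⟨c / β, by positivity, fun ω x y hxy => ?_⟩
  have hbc : ∀ t, 0 ≤ t → ‖T t‖ ≤ c := fun t ht => (hb t ht).trans
    (mul_le_of_le_one_right hc.le (Real.exp_le_one_iff.2 (by nlinarith)))
  set N := ‖((ω : ℂ) * Complex.I) • x - y‖ with hN
  set e : ℝ → ℂ := fun t => Complex.exp (-((ω : ℂ) * Complex.I) * t) with he
  have hen : ∀ t, ‖e t‖ = 1 := fun t => by
    have : -((ω : ℂ) * Complex.I) * t = ((-(ω * t) : ℝ) : ℂ) * Complex.I := by push_cast; ring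
    rw [he]
    simp only
    rw [this, Complex.norm_exp_ofReal_mul_I]
  have hed : ∀ t, HasDerivAt e (e t * -((ω : ℂ) * Complex.I)) t := fun t => by
    have h1 : HasDerivAt (fun t : ℝ => -((ω : ℂ) * Complex.I) * (t : ℂ))
        (-((ω : ℂ) * Complex.I)) t := by
      simpa using (Complex.ofRealCLM.hasDerivAt (x := t)).const_mul (-((ω : ℂ) * Complex.I))
    exact h1.cexp
  set F : ℝ → X := fun t => e t • T t x with hF
  have hF' : ∀ t, 0 ≤ t →
      HasDerivWithinAt F (e t • T t (y - ((ω : ℂ) * Complex.I) • x)) (Ici t) t := by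
    intro t ht
    refine ((hed t).hasDerivWithinAt.smul
      (hT.hasDerivWithinAt ((hgen x y).1 hxy) ht)).congr_deriv ?_
    rw [map_sub, map_smul]
    module
  have hcont : ContinuousOn F (Ici 0) := by
    have h1 : Continuous fun t : ℝ => e t • T (max t 0) x :=
      (continuous_iff_continuousAt.2 fun t => (hed t).continuousAt).smul (hT.continuous_max hbc x)
    refine h1.continuousOn.congr fun t ht => ?_
    simp only [hF]
    rw [max_eq_left ht]
  have hbound : ∀ t, 0 ≤ t → ‖F t - x‖ ≤ c / β * N := by
    intro t ht
    have hBd : ∀ s : ℝ, HasDerivAt (fun s => c / β * N * (1 - Real.exp (-(β * s))))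
        (c * Real.exp (-(β * s)) * N) s := by
      intro s
      have h1 : HasDerivAt (fun s : ℝ => -(β * s)) (-β) s := by
        have := ((hasDerivAt_id s).const_mul β).fun_neg
        rwa [mul_one] at this
      refine ((h1.exp.const_sub 1).const_mul (c / β * N)).congr_deriv ?_
      field_simp
    have := image_norm_le_of_norm_deriv_right_le_deriv_boundary (a := 0) (b := t)
      (f := fun s => F s - x) (f' := fun s => e s • T s (y - ((ω : ℂ) * Complex.I) • x))
      ((hcont.mono Icc_subset_Ici_self).sub continuousOn_const)
      (fun s hs => (hF' s hs.1).sub_const x) (by simp [hF, he, hT.map_zero]) hBd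
      (fun s hs => by
        rw [norm_smul, hen, one_mul, hN, norm_sub_rev _ y]
        exact (T s).le_of_opNorm_le (hb s hs.1) _) ⟨ht, le_rfl⟩
    refine this.trans ?_
    have h1 : 0 ≤ c / β * N := by positivity
    have h2 := Real.exp_pos (-(β * t))
    nlinarith
  have hlim : Tendsto (fun t : ℝ => c * Real.exp (-(β * t)) * ‖x‖ + c / β * N) atTop
      (𝓝 (c * 0 * ‖x‖ + c / β * N)) := by
    refine (((Real.tendsto_exp_atBot.comp ?_).const_mul c).mul_const _).add_const _
    exact tendsto_neg_atTop_atBot.comp (tendsto_id.const_mul_atTop hβ)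
  rw [mul_zero, zero_mul, zero_add] at hlim
  refine ge_of_tendsto hlim ?_
  filter_upwards [eventually_ge_atTop 0] with t ht
  have h1 : ‖F t‖ ≤ c * Real.exp (-(β * t)) * ‖x‖ := by
    rw [hF]
    simp only
    rw [norm_smul, hen, one_mul]
    exact (T t).le_of_opNorm_le (hb t ht) x
  have h2 : ‖x‖ ≤ ‖F t‖ + ‖F t - x‖ := by
    have := norm_sub_le (F t) (F t - x)
    rwa [sub_sub_cancel] at this
  linarith [hbound t ht]

/-- The preimage of `x` is `-∫₀^∞ T(t) x dt`: applying `T(h)` shifts the integral, so the difference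
quotient is the mean of the orbit over `[0, h]`. -/
theorem GeneratesExpStable.surjective [CompleteSpace X] {A : X →ₗ.[ℂ] X}
    (hA : GeneratesExpStable A) (x : X) : ∃ y, (y, x) ∈ A.graph := by
  obtain ⟨T, hT, hgen, c, β, hc, hβ, hb⟩ := hA
  have hbc : ∀ t, 0 ≤ t → ‖T t‖ ≤ c := fun t ht => (hb t ht).trans
    (mul_le_of_le_one_right hc.le (Real.exp_le_one_iff.2 (by nlinarith)))
  set g : ℝ → X := fun t => T (max t 0) x with hg
  have hgc : Continuous g := hT.continuous_max hbc x
  have hgi : IntegrableOn g (Ioi 0) := by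
    have h1 : IntegrableOn (fun t : ℝ => c * Real.exp (-β * t) * ‖x‖) (Ioi 0) :=
      ((exp_neg_integrableOn_Ioi 0 hβ).const_mul c).mul_const _
    refine h1.mono' hgc.aestronglyMeasurable ?_
    filter_upwards [ae_restrict_mem measurableSet_Ioi] with t ht
    have ht' : 0 < t := ht
    rw [hg]
    simp only
    rw [max_eq_left ht'.le, neg_mul]
    exact (T t).le_of_opNorm_le (hb t ht'.le) x
  refine ⟨-∫ t in Ioi 0, g t, (hgen _ _).2 ?_⟩
  have hkey : ∀ h : ℝ, 0 < h → T h (-∫ t in Ioi 0, g t) - (-∫ t in Ioi 0, g t)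
      = ∫ t in (0 : ℝ)..h, g t := by
    intro h hh
    have h1 : T h (∫ t in Ioi 0, g t) = ∫ t in Ioi h, g t := by
      rw [← (T h).integral_comp_comm hgi]
      have h2 := (measurePreserving_add_right volume h).setIntegral_preimage_emb
        (measurableEmbedding_addRight h) g (Ioi h)
      have h3 : (fun s => s + h) ⁻¹' Ioi h = Ioi 0 := by ext s; simp
      rw [← h2, h3]
      refine setIntegral_congr_fun measurableSet_Ioi fun s hs => ?_
      have hs' : 0 < s := hs
      simp only [hg]
      rw [max_eq_left hs'.le, max_eq_left (by positivity), add_comm s h,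
        hT.map_add _ _ hh.le hs'.le]
      rfl
    rw [map_neg, h1, ← intervalIntegral.integral_Ioi_sub_Ioi hgi hh.le]
    abel
  have hd : HasDerivAt (fun u => ∫ t in (0 : ℝ)..u, g t) (g 0) 0 :=
    intervalIntegral.integral_hasDerivAt_right (hgc.intervalIntegrable _ _)
      (hgc.stronglyMeasurableAtFilter _ _) hgc.continuousAt
  have h1 := (hasDerivWithinAt_iff_tendsto_slope' self_notMem_Ioi).1
    (hd.hasDerivWithinAt (s := Ioi 0))
  have hg0 : g 0 = x := by simp [hg, hT.map_zero]
  rw [hg0] at h1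
  refine h1.congr' ?_
  filter_upwards [self_mem_nhdsWithin] with h hh
  rw [hkey h hh, slope_def_module, intervalIntegral.integral_same, sub_zero, sub_zero,
    Complex.coe_smul]

end Necessity

/-! ### The generator of a system with bounded phase inverse -/

section PseudoInverseBounded

variable {H : Type*} [NormedAddCommGroup H] [InnerProductSpace ℂ H]

theorem mem_nullSpace_iff (A : H →ₗ.[ℂ] H) (y : H) : y ∈ nullSpace A ↔ (y, 0) ∈ A.graph := by
  rw [nullSpace, Submodule.mem_map, LinearPMap.mem_graph_iff]
  constructor
  · rintro ⟨z, hz, rfl⟩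
    exact ⟨z, rfl, hz⟩
  · rintro ⟨z, hz, h0⟩
    exact ⟨z, h0, hz⟩

variable {A : H →ₗ.[ℂ] H} {B : H →L[ℂ] H}

theorem apply_mem_orthogonal_nullSpace (hAB : ∀ p q, (p, q) ∈ A.graph ↔ B p = q)
    (hB : IsDissipative B) (z : H) : B z ∈ (nullSpace A)ᗮ := by
  rw [Submodule.mem_orthogonal']
  intro y hy
  rw [mem_nullSpace_iff, hAB] at hy
  exact hB.inner_apply_eq_zero hy z

variable [CompleteSpace H]

/-- The range of a dissipative operator is orthogonal to its kernel, so `B` maps the phase space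
into itself and is injective there. -/
theorem ResolventBound.generatesExpStable (hAB : ∀ p q, (p, q) ∈ A.graph ↔ B p = q)
    (hB : IsDissipative B) {K : ℝ} (hK : 0 ≤ K) (h : ResolventBound B K) :
    GeneratesExpStable (pseudoInverse A) := by
  set V := (nullSpace A)ᗮ with hV
  set B' : V →L[ℂ] V := (B.comp V.subtypeL).codRestrict V
    fun z => apply_mem_orthogonal_nullSpace hAB hB z with hB'
  have hcoe : ∀ y : V, ((B' y : V) : H) = B y := fun y => rfl
  obtain ⟨T, hT, hgen, hexp⟩ := exists_expStable_semigroup (B := B')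
    (fun y => hB (y : H))
    (fun y hy => by
      have h1 : B (y : H) = 0 := by rw [← hcoe, hy, Submodule.coe_zero]
      have h2 : (y : H) ∈ nullSpace A := by rw [mem_nullSpace_iff, hAB, h1]
      exact Subtype.ext (inner_self_eq_zero.1 ((Submodule.mem_orthogonal _ _).1 y.2 _ h2)))
    hK (fun ω y => h ω (y : H))
  refine ⟨T, hT, fun x y => ?_, hexp⟩
  rw [← hgen x y, mem_graph_pseudoInverse, hAB, ← hcoe]
  exact Subtype.coe_inj

/-- Stability gives the bound on the phase space only. A kernel component `n` of `y` leaves `B y`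
unchanged and enters `iω B y - y` orthogonally, so it can only enlarge the right side. -/
theorem GeneratesExpStable.exists_resolventBound (hAB : ∀ p q, (p, q) ∈ A.graph ↔ B p = q)
    (hB : IsDissipative B) (h : GeneratesExpStable (pseudoInverse A)) :
    ∃ K : ℝ, 0 ≤ K ∧ ResolventBound B K := by
  obtain ⟨K, hK, hbound⟩ := h.exists_resolvent_bound
  refine ⟨K, hK, fun ω y => ?_⟩
  have hclosed : IsClosed (nullSpace A : Set H) := by
    have : (nullSpace A : Set H) = B ⁻¹' {0} := by
      ext y
      rw [SetLike.mem_coe, mem_nullSpace_iff, hAB]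
      rfl
    rw [this]
    exact isClosed_singleton.preimage B.continuous
  have : CompleteSpace (nullSpace A) := hclosed.completeSpace_coe
  obtain ⟨n, hn, y', hy', rfl⟩ := (nullSpace A).exists_add_mem_mem_orthogonal y
  have hn0 : B n = 0 := by rwa [mem_nullSpace_iff, hAB] at hn
  have hBy' := apply_mem_orthogonal_nullSpace hAB hB y'
  have h1 := hbound ω ⟨B y', hBy'⟩ ⟨y', hy'⟩ (by rw [mem_graph_pseudoInverse, hAB])
  set z := ((ω : ℂ) * Complex.I) • B y' - y' with hz
  have hzmem : z ∈ (nullSpace A)ᗮ := Submodule.sub_mem _ (Submodule.smul_mem _ _ hBy') hy'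
  have e : ((ω : ℂ) * Complex.I) • B (n + y') - (n + y') = z - n := by
    rw [map_add, hn0, zero_add, hz]
    abel
  rw [e, map_add, hn0, zero_add]
  refine (show ‖B y'‖ ≤ K * ‖z‖ from h1).trans ?_
  gcongr
  have h2 : ⟪z, n⟫_ℂ = 0 := (Submodule.mem_orthogonal' _ _).1 hzmem n hn
  have h3 := norm_sub_sq (𝕜 := ℂ) z n
  rw [h2] at h3
  refine (pow_le_pow_iff_left₀ (norm_nonneg _) (norm_nonneg _) two_ne_zero).1 ?_
  rw [h3]
  simp

end PseudoInverseBounded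

/-! ### The phase space operators -/

section Phase

variable {Y : Type*} [NormedAddCommGroup Y] [InnerProductSpace ℂ Y]

/-- The skew part `[[0, -S], [S, 0]]` of the phase operator, for bounded `S`. -/
def phaseSkew (S : Y →L[ℂ] Y) : WithLp 2 (Y × Y) →L[ℂ] WithLp 2 (Y × Y) :=
  (WithLp.prodContinuousLinearEquiv 2 ℂ Y Y).symm.toContinuousLinearMap.comp
    ((-(S.comp (WithLp.sndL 2 ℂ Y Y))).prod (S.comp (WithLp.fstL 2 ℂ Y Y)))

/-- The damping `[[C, 0], [0, 0]]` as an operator on the phase space. -/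
def phaseDamping (C : Y →L[ℂ] Y) : WithLp 2 (Y × Y) →L[ℂ] WithLp 2 (Y × Y) :=
  (WithLp.prodContinuousLinearEquiv 2 ℂ Y Y).symm.toContinuousLinearMap.comp
    ((C.comp (WithLp.fstL 2 ℂ Y Y)).prod 0)

theorem phaseSkew_apply (S : Y →L[ℂ] Y) (p : WithLp 2 (Y × Y)) :
    phaseSkew S p = WithLp.toLp 2 (-(S p.snd), S p.fst) := rfl

theorem phaseDamping_apply (C : Y →L[ℂ] Y) (p : WithLp 2 (Y × Y)) :
    phaseDamping C p = WithLp.toLp 2 (C p.fst, 0) := rfl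

theorem inner_phaseDamping (C : Y →L[ℂ] Y) (p q : WithLp 2 (Y × Y)) :
    ⟪phaseDamping C p, q⟫_ℂ = ⟪C p.fst, q.fst⟫_ℂ := by
  simp [phaseDamping_apply, WithLp.prod_inner_apply]

theorem inner_phaseSkew {S : Y →L[ℂ] Y} (hS : ∀ x y, ⟪S x, y⟫_ℂ = ⟪x, S y⟫_ℂ)
    (p q : WithLp 2 (Y × Y)) : ⟪phaseSkew S p, q⟫_ℂ = -⟪p, phaseSkew S q⟫_ℂ := by
  simp only [phaseSkew_apply, WithLp.prod_inner_apply, inner_neg_left, inner_neg_right]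
  change -⟪S p.snd, q.fst⟫_ℂ + ⟪S p.fst, q.snd⟫_ℂ = -(-⟪p.fst, S q.snd⟫_ℂ + ⟪p.snd, S q.fst⟫_ℂ)
  rw [hS, hS]
  ring

theorem isPositive_phaseDamping [CompleteSpace Y] {C : Y →L[ℂ] Y} (hC : C.IsPositive) :
    (phaseDamping C).IsPositive := by
  refine ⟨fun p q => ?_, fun p => ?_⟩
  · change ⟪phaseDamping C p, q⟫_ℂ = ⟪p, phaseDamping C q⟫_ℂ
    rw [inner_phaseDamping, ← inner_conj_symm p, inner_phaseDamping, inner_conj_symm]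
    exact hC.1 _ _
  · rw [ContinuousLinearMap.reApplyInnerSelf_apply, inner_phaseDamping]
    exact hC.re_inner_nonneg_left _

theorem mem_graph_phaseInverse_iff (S : Y →ₗ.[ℂ] Y) (C : Y →L[ℂ] Y) (p q : WithLp 2 (Y × Y)) :
    (p, q) ∈ (phaseInverse S C).graph ↔
      (p.fst, q.snd) ∈ S.graph ∧ (p.snd, -q.fst - C p.fst) ∈ S.graph := by
  simp only [LinearPMap.mem_graph_iff]
  constructor
  · rintro ⟨z, hz1, hz2⟩
    subst hz1 hz2
    refine ⟨⟨⟨_, z.2.1⟩, rfl, rfl⟩, ⟨⟨_, z.2.2⟩, rfl, ?_⟩⟩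
    change S ⟨z.1.snd, z.2.2⟩ = -(-(C z.1.fst) - S ⟨z.1.snd, z.2.2⟩) - C z.1.fst
    abel
  · rintro ⟨⟨a, ha1, ha2⟩, ⟨b, hb1, hb2⟩⟩
    refine ⟨⟨p, ha1 ▸ a.2, hb1 ▸ b.2⟩, rfl, ?_⟩
    have ea : a = ⟨p.fst, ha1 ▸ a.2⟩ := Subtype.ext ha1
    have eb : b = ⟨p.snd, hb1 ▸ b.2⟩ := Subtype.ext hb1
    rw [ea] at ha2
    rw [eb] at hb2
    change WithLp.toLp 2 (-(C p.fst) - S ⟨p.snd, _⟩, S ⟨p.fst, _⟩) = q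
    rw [ha2, hb2]
    apply WithLp.ofLp_injective
    ext
    · change -(C p.fst) - (-q.fst - C p.fst) = q.fst
      abel
    · rfl

theorem mem_graph_phaseInverse_iff_of_bounded {S : Y →ₗ.[ℂ] Y} {S' : Y →L[ℂ] Y}
    (hS' : ∀ x y, (x, y) ∈ S.graph ↔ S' x = y) (C : Y →L[ℂ] Y) (p q : WithLp 2 (Y × Y)) :
    (p, q) ∈ (phaseInverse S C).graph ↔ (phaseSkew S' - phaseDamping C) p = q := by
  rw [mem_graph_phaseInverse_iff, hS', hS', sub_apply, phaseSkew_apply, phaseDamping_apply,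
    ← WithLp.toLp_sub]
  constructor
  · rintro ⟨h1, h2⟩
    apply WithLp.ofLp_injective
    ext
    · change -(S' p.snd) - C p.fst = q.fst
      rw [h2]
      abel
    · change S' p.fst - 0 = q.snd
      rw [h1, sub_zero]
  · rintro rfl
    refine ⟨?_, ?_⟩
    · change S' p.fst = S' p.fst - 0
      rw [sub_zero]
    · change S' p.snd = -(-(S' p.snd) - C p.fst) - C p.fst
      abel

variable [CompleteSpace Y]

theorem apply_eq_zero_of_re_inner_eq_zero {C : Y →L[ℂ] Y} (hC : C.IsPositive) {x : Y}
    (hx : (⟪C x, x⟫_ℂ).re = 0) : C x = 0 := by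
  have := norm_inner_sq_le_of_isPositive hC (C x) x
  rw [hx, mul_zero] at this
  have h1 : ‖⟪C x, C x⟫_ℂ‖ = 0 := by nlinarith [norm_nonneg ⟪C x, C x⟫_ℂ]
  exact inner_self_eq_zero.1 (norm_eq_zero.1 h1)

theorem inner_eq_of_mem_graph {S : Y →ₗ.[ℂ] Y} (hS : IsSelfAdjoint S) {x y x' y' : Y}
    (h : (x, y) ∈ S.graph) (h' : (x', y') ∈ S.graph) : ⟪y, x'⟫_ℂ = ⟪x, y'⟫_ℂ := by
  have hf := LinearPMap.adjoint_isFormalAdjoint hS.dense_domain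
  rw [LinearPMap.isSelfAdjoint_def.1 hS] at hf
  rw [LinearPMap.mem_graph_iff] at h h'
  obtain ⟨z, rfl, rfl⟩ := h
  obtain ⟨z', rfl, rfl⟩ := h'
  exact hf z z'

/-- Exponential stability forces the square root of the mass operator to be everywhere defined. -/
theorem domain_eq_top_of_generatesExpStable {S : Y →ₗ.[ℂ] Y} (hS : IsSelfAdjoint S) {C : Y →L[ℂ] Y}
    (hC : C.IsPositive) (h : GeneratesExpStable (phaseGenerator S C)) (v : Y) : v ∈ S.domain := by
  have hclosed : IsClosed (nullSpace S : Set Y) := by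
    have : (nullSpace S : Set Y) = (fun y => (y, (0 : Y))) ⁻¹' (S.graph : Set (Y × Y)) := by
      ext y
      exact mem_nullSpace_iff S y
    rw [this]
    exact hS.isClosed.preimage (by fun_prop)
  have : CompleteSpace (nullSpace S) := hclosed.completeSpace_coe
  obtain ⟨n, hn, w, hw, rfl⟩ := (nullSpace S).exists_add_mem_mem_orthogonal v
  refine S.domain.add_mem ?_ ?_
  · rw [mem_nullSpace_iff] at hn
    exact LinearPMap.mem_domain_of_mem_graph hn
  -- If `(u, v)` is in the null-space, then `S u = 0` and `S v = -C u`, so symmetry gives `⟪C u, u⟫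
  -- = 0`. Positivity yields `C u = 0`, hence `v ∈ ker S`, which is orthogonal to `w`.
  · have hmem : WithLp.toLp 2 ((0 : Y), w) ∈ (nullSpace (phaseInverse S C))ᗮ := by
      rw [Submodule.mem_orthogonal]
      intro p hp
      rw [mem_nullSpace_iff, mem_graph_phaseInverse_iff] at hp
      obtain ⟨h1, h2⟩ := hp
      change (p.fst, (0 : Y)) ∈ S.graph at h1
      change (p.snd, -(0 : Y) - C p.fst) ∈ S.graph at h2
      have h3 := inner_eq_of_mem_graph hS h2 h1
      have h4 : C p.fst = 0 := by
        apply apply_eq_zero_of_re_inner_eq_zero hC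
        rw [neg_zero, zero_sub, inner_neg_left, inner_zero_right, neg_eq_zero] at h3
        rw [h3, Complex.zero_re]
      rw [h4, neg_zero, sub_zero, ← mem_nullSpace_iff] at h2
      simp only [WithLp.prod_inner_apply]
      change ⟪p.fst, (0 : Y)⟫_ℂ + ⟪p.snd, w⟫_ℂ = 0
      rw [inner_zero_right, (Submodule.mem_orthogonal _ _).1 hw _ h2, add_zero]
    -- The range of the generator lies in the domain of the phase operator, so surjectivity places
    -- `w` in the domain of `S`.
    obtain ⟨y, hy⟩ := h.surjective ⟨_, hmem⟩
    rw [phaseGenerator, mem_graph_pseudoInverse, mem_graph_phaseInverse_iff] at hy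
    exact LinearPMap.mem_domain_of_mem_graph hy.2

/-- Hellinger–Toeplitz: an everywhere defined symmetric operator is bounded. -/
theorem exists_bounded_of_domain_eq_top {S : Y →ₗ.[ℂ] Y} (hS : IsSelfAdjoint S)
    (h : ∀ v, v ∈ S.domain) : ∃ S' : Y →L[ℂ] Y, (∀ x y, ⟪S' x, y⟫_ℂ = ⟪x, S' y⟫_ℂ) ∧
      ∀ x y, (x, y) ∈ S.graph ↔ S' x = y := by
  set L : Y →ₗ[ℂ] Y := S.toFun.comp (LinearMap.id.codRestrict S.domain h) with hL
  have hg : ∀ x y, (x, y) ∈ S.graph ↔ L x = y := fun x y => by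
    rw [LinearPMap.mem_graph_iff]
    constructor
    · rintro ⟨z, hz1, hz2⟩
      simp only at hz1 hz2
      subst hz1 hz2
      rfl
    · rintro rfl
      exact ⟨⟨x, h x⟩, rfl, rfl⟩
  have hsymm : L.IsSymmetric := fun x y =>
    inner_eq_of_mem_graph hS ((hg x _).2 rfl) ((hg y _).2 rfl)
  exact ⟨⟨L, hsymm.continuous⟩, hsymm, hg⟩

/-- Exponential stability is shared by mutually dominated dampings. -/
theorem ExpStable.of_comparable {M : Y →ₗ.[ℂ] Y} {C D : Y →L[ℂ] Y} (hC : C.IsPositive)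
    (hD : D.IsPositive) {a : ℝ} (ha : 0 ≤ a) (hCD : ∀ x, (⟪C x, x⟫_ℂ).re ≤ a * (⟪D x, x⟫_ℂ).re)
    (hDC : ∀ x, (⟪D x, x⟫_ℂ).re ≤ a * (⟪C x, x⟫_ℂ).re) (h : ExpStable M C) : ExpStable M D := by
  obtain ⟨S, hS, hgen⟩ := h
  refine ⟨S, hS, ?_⟩
  have hSA : IsSelfAdjoint S := hS.1.1
  obtain ⟨S', hsymm, hS'⟩ := exists_bounded_of_domain_eq_top hSA
    (domain_eq_top_of_generatesExpStable hSA hC hgen)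
  have hJ := inner_phaseSkew hsymm
  have hPC := isPositive_phaseDamping hC
  have hPD := isPositive_phaseDamping hD
  obtain ⟨K, hK, hb⟩ := GeneratesExpStable.exists_resolventBound
    (mem_graph_phaseInverse_iff_of_bounded hS' C) (isDissipative_sub hJ hPC) hgen
  exact (hb.of_comparable hJ hPC hPD ha hK
    (fun p => by simpa only [inner_phaseDamping] using hCD p.fst)
    (fun p => by simpa only [inner_phaseDamping] using hDC p.fst)).generatesExpStable
    (mem_graph_phaseInverse_iff_of_bounded hS' D) (isDissipative_sub hJ hPD) (by positivity)

end Phase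

/-! ### From the operator order to quadratic forms, and the main theorem -/

theorem re_inner_le_of_le {Y : Type*} [NormedAddCommGroup Y] [InnerProductSpace ℂ Y]
    {C D : Y →L[ℂ] Y} (h : C ≤ D) (x : Y) : (⟪C x, x⟫_ℂ).re ≤ (⟪D x, x⟫_ℂ).re := by
  have := (ContinuousLinearMap.le_def C D).1 h |>.re_inner_nonneg_left x
  rw [sub_apply, inner_sub_left, RCLike.re_eq_complex_re, Complex.sub_re] at this
  linarith

theorem re_inner_ofReal_smul {Y : Type*} [NormedAddCommGroup Y] [InnerProductSpace ℂ Y]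
    (α : ℝ) (C : Y →L[ℂ] Y) (x : Y) :
    (⟪((α : ℂ) • C) x, x⟫_ℂ).re = α * (⟪C x, x⟫_ℂ).re := by
  rw [smul_apply, inner_smul_left, Complex.conj_ofReal, Complex.re_ofReal_mul]

end DampedSystem

end

theorem theorem4 {Y : Type*} [NormedAddCommGroup Y] [InnerProductSpace ℂ Y] [CompleteSpace Y]
    (M : Y →ₗ.[ℂ] Y) (hM : DampedSystem.IsPositiveSelfAdjoint M) :
    (∀ (C D : Y →L[ℂ] Y) (α : ℝ), 0 ≤ C → C ≤ D → D ≤ (α : ℂ) • C →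
      (DampedSystem.ExpStable M C ↔ DampedSystem.ExpStable M D)) ∧
    (∀ C : Y →L[ℂ] Y, 0 ≤ C → DampedSystem.ExpStable M C →
      ∀ α : ℝ, 0 < α → DampedSystem.ExpStable M ((α : ℂ) • C)) := by
  have hpos : ∀ {C : Y →L[ℂ] Y}, 0 ≤ C → C.IsPositive ∧ ∀ x, 0 ≤ (⟪C x, x⟫_ℂ).re := fun hC =>
    have hC' := (ContinuousLinearMap.nonneg_iff_isPositive _).1 hC
    ⟨hC', fun x => hC'.re_inner_nonneg_left x⟩
  refine ⟨fun C D α hC hCD hDC => ?_, fun C hC hstab α hα => ?_⟩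
  · obtain ⟨hC', hCnn⟩ := hpos hC
    obtain ⟨hD', hDnn⟩ := hpos (hC.trans hCD)
    -- One nonnegative constant must serve both directions: `C ≤ D` needs at least `1`, `D ≤ α C`
    -- needs at least `α`.
    have h0 : (0 : ℝ) ≤ max α 1 := zero_le_one.trans (le_max_right _ _)
    have h1 : ∀ x, (⟪C x, x⟫_ℂ).re ≤ max α 1 * (⟪D x, x⟫_ℂ).re := fun x =>
      (DampedSystem.re_inner_le_of_le hCD x).trans
        (le_mul_of_one_le_left (hDnn x) (le_max_right _ _))
    have h2 : ∀ x, (⟪D x, x⟫_ℂ).re ≤ max α 1 * (⟪C x, x⟫_ℂ).re := fun x => by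
      refine (DampedSystem.re_inner_le_of_le hDC x).trans ?_
      rw [DampedSystem.re_inner_ofReal_smul]
      exact mul_le_mul_of_nonneg_right (le_max_left _ _) (hCnn x)
    exact ⟨DampedSystem.ExpStable.of_comparable hC' hD' h0 h1 h2,
      DampedSystem.ExpStable.of_comparable hD' hC' h0 h2 h1⟩
  · obtain ⟨hC', hCnn⟩ := hpos hC
    have hαC : ((α : ℂ) • C).IsPositive :=
      hC'.smul_of_nonneg (by exact_mod_cast hα.le)
    refine DampedSystem.ExpStable.of_comparable (a := max α α⁻¹) hC' hαC
      (hα.le.trans (le_max_left _ _)) (fun x => ?_) (fun x => ?_) hstab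
    · rw [DampedSystem.re_inner_ofReal_smul, ← mul_assoc]
      refine le_mul_of_one_le_left (hCnn x) ?_
      rw [← inv_mul_cancel₀ hα.ne']
      gcongr
      exact le_max_right _ _
    · rw [DampedSystem.re_inner_ofReal_smul]
      exact mul_le_mul_of_nonneg_right (le_max_left _ _) (hCnn x)
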